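/- Let $k$ be a commutative ring, $A$ a ($\mathbb Z$-graded, unital) dg-algebra over $k$, and $\mathcal D(A,d)$ the derived category of right dg-$A$-modules. For an object $U$ let $\operatorname{Add}U$ (respectively $\operatorname{add}U$) be the class of direct summands of arbitrary set-indexed (respectively finite) coproducts of copies of $U$. For a class $\mathcal C$ of objects write $\dim_{\mathcal C}X\le n$ (respectively $\operatorname{codim}_{\mathcal C}X\le n$) if there are distinguished triangles $X_{i+1}\to C_i\to X_i\to X_{i+1}[1]$ (respectively $X_i\to C_i\to X_{i+1}\to X_i[1]$), $0\le i\le n$, with $C_i\in\mathcal C$, $X_0\cong X$ and $X_{n+1}=0$; triangles of the second kind are called a coresolution of $X$ by $\mathcal C$, with terms $C_0,\dots,C_n$. The object $U$ is *silting* if $\dim_{\operatorname{Add}A}U<\infty$, $\operatorname{Hom}(U,U^{(I)}[i])=0$ for all sets $I$ and all $i>0$, and $\operatorname{codim}_{\operatorname{Add}U}A<\infty$; it is *good silting* if moreover $\operatorname{codim}_{\operatorname{add}U}A<\infty$; for $n\in\mathbb N$, a silting object is *$n$-silting* if $\operatorname{codim}_{\operatorname{Add}U}A\le n$ (or, in the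 alternative description, if $\dim_{\operatorname{Add}A}U\le n$). **Lemma.** For every silting object $U$ of $\mathcal D(A,d)$ there is a good silting object $U'$ with $\operatorname{Add}U'=\operatorname{Add}U$ such that, for every $n\in\mathbb N$, if $U$ is $n$-silting then $U'$ is $n$-silting; this holds for either of the two descriptions of $n$-silting (the same one being used for $U$ and $U'$). Moreover $U'$ can be chosen to be (isomorphic to) the direct sum of the terms of a coresolution of $A$ by $\operatorname{Add}U$. -/

import Mathlib

open CategoryTheory CategoryTheory.Limits CategoryTheory.Pretriangulated MulOpposite

universe v u

noncomputable section

/-! ### Differential graded algebras and right differential graded modules -/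

/-- A dg-algebra over the commutative ring `k`: a `ℤ`-graded unital `k`-algebra (the underlying
algebra is the internal direct sum of the `k`-submodules `gr i`) with a `k`-linear differential of
degree `1` satisfying the graded Leibniz rule. -/
structure DGAlgebra (k : Type v) [CommRing k] where
  carrier : Type u
  [ring : Ring carrier]
  [algebra : Algebra k carrier]
  gr : ℤ → Submodule k carrier
  gr_indep : iSupIndep gr
  gr_span : ⨆ i, gr i = ⊤
  one_mem : (1 : carrier) ∈ gr 0
  mul_mem : ∀ (i j : ℤ) (a b : carrier), a ∈ gr i → b ∈ gr j → a * b ∈ gr (i + j)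
  d : carrier →ₗ[k] carrier
  d_mem : ∀ (i : ℤ) (a : carrier), a ∈ gr i → d a ∈ gr (i + 1)
  d_d : ∀ a : carrier, d (d a) = 0
  leibniz : ∀ (i : ℤ) (a b : carrier), a ∈ gr i →
    d (a * b) = d a * b + i.negOnePow • (a * d b)

attribute [instance] DGAlgebra.ring DGAlgebra.algebra

variable {k : Type v} [CommRing k]

/-- A right dg-module over the dg-algebra `A`. The right action of `a` on `x` is `op a • x`.
The ground ring `k` acts on the module through `k → A`; since the image of `k` lies in degree `0`
and is killed by the differential of `A`, the homogeneous components are automatically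
`k`-submodules and the differential is automatically `k`-linear. -/
structure DGModule (A : DGAlgebra.{v, u} k) where
  carrier : Type u
  [addCommGroup : AddCommGroup carrier]
  [module : Module A.carrierᵐᵒᵖ carrier]
  gr : ℤ → AddSubgroup carrier
  gr_indep : iSupIndep gr
  gr_span : ⨆ i, gr i = ⊤
  smul_mem : ∀ (i j : ℤ) (x : carrier) (a : A.carrier),
    x ∈ gr i → a ∈ A.gr j → op a • x ∈ gr (i + j)
  d : carrier →+ carrier
  d_mem : ∀ (i : ℤ) (x : carrier), x ∈ gr i → d x ∈ gr (i + 1)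
  d_d : ∀ x : carrier, d (d x) = 0
  leibniz : ∀ (i : ℤ) (x : carrier) (a : A.carrier), x ∈ gr i →
    d (op a • x) = op a • d x + i.negOnePow • (op (A.d a) • x)

attribute [instance] DGModule.addCommGroup DGModule.module

namespace DGModule

variable {A : DGAlgebra.{v, u} k}

/-- Morphisms of dg-modules: `A`-linear maps of degree `0` commuting with the differentials. -/
@[ext]
structure Hom (M N : DGModule A) where
  toFun : M.carrier →ₗ[A.carrierᵐᵒᵖ] N.carrier
  map_mem : ∀ (i : ℤ) (x : M.carrier), x ∈ M.gr i → toFun x ∈ N.gr i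
  map_d : ∀ x : M.carrier, toFun (M.d x) = N.d (toFun x)

/-- The category of right dg-modules over `A`. -/
instance : Category (DGModule A) where
  Hom M N := Hom M N
  id M := ⟨LinearMap.id, fun _ _ h => h, fun _ => rfl⟩
  comp f g := ⟨g.toFun ∘ₗ f.toFun, fun i x h => g.map_mem i _ (f.map_mem i x h),
    fun x => by simp [f.map_d, g.map_d]⟩

@[ext]
lemma hom_ext {M N : DGModule A} {f g : M ⟶ N} (h : ∀ x, f.toFun x = g.toFun x) : f = g :=
  Hom.ext (LinearMap.ext h)

@[simp]
lemma id_toFun (M : DGModule A) (x : M.carrier) : Hom.toFun (𝟙 M) x = x := rfl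

@[simp]
lemma comp_toFun {M N P : DGModule A} (f : M ⟶ N) (g : N ⟶ P) (x : M.carrier) :
    (f ≫ g).toFun x = g.toFun (f.toFun x) := rfl

/-! ### Cohomology -/

/-- The `n`-cocycles. -/
def cocycles (M : DGModule A) (n : ℤ) : AddSubgroup M.carrier := M.gr n ⊓ M.d.ker

/-- The `n`-coboundaries. -/
def coboundaries (M : DGModule A) (n : ℤ) : AddSubgroup M.carrier := (M.gr (n - 1)).map M.d

/-- The `n`-th cohomology group. -/
abbrev H (M : DGModule A) (n : ℤ) : Type u :=
  M.cocycles n ⧸ (M.coboundaries n).addSubgroupOf (M.cocycles n)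

lemma map_cocycles {M N : DGModule A} (f : M ⟶ N) (n : ℤ) {x : M.carrier}
    (hx : x ∈ M.cocycles n) : f.toFun x ∈ N.cocycles n := by
  refine ⟨f.map_mem n x hx.1, ?_⟩
  have h : M.d x = 0 := hx.2
  change N.d (f.toFun x) = 0
  rw [← f.map_d, h, map_zero]

lemma map_coboundaries {M N : DGModule A} (f : M ⟶ N) (n : ℤ) {x : M.carrier}
    (hx : x ∈ M.coboundaries n) : f.toFun x ∈ N.coboundaries n := by
  obtain ⟨y, hy, rfl⟩ := hx
  exact ⟨f.toFun y, f.map_mem _ _ hy, (f.map_d y).symm⟩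

/-- The map on cocycles induced by a morphism. -/
def cocyclesMap {M N : DGModule A} (f : M ⟶ N) (n : ℤ) : M.cocycles n →+ N.cocycles n :=
  (f.toFun.toAddMonoidHom.comp (M.cocycles n).subtype).codRestrict (N.cocycles n)
    (fun x => map_cocycles f n x.2)

@[simp]
lemma cocyclesMap_coe {M N : DGModule A} (f : M ⟶ N) (n : ℤ) (x : M.cocycles n) :
    (cocyclesMap f n x : N.carrier) = f.toFun x := rfl

/-- The map on cohomology induced by a morphism. -/
def HMap {M N : DGModule A} (f : M ⟶ N) (n : ℤ) : M.H n →+ N.H n :=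
  QuotientAddGroup.map _ _ (cocyclesMap f n) (fun _ hx => map_coboundaries f n hx)

/-- The `n`-th cohomology as a functor on dg-modules. -/
def cohomology (A : DGAlgebra.{v, u} k) (n : ℤ) : DGModule A ⥤ AddCommGrpCat.{u} where
  obj M := AddCommGrpCat.of (M.H n)
  map f := AddCommGrpCat.ofHom (HMap f n)
  map_id M := by
    ext x
    rfl
  map_comp f g := by
    ext x
    rfl

/-! ### The homotopy category -/

/-- `f` and `g` are homotopic if `f - g = s d + d s` for some graded `A`-linear map `s` of
degree `-1`. -/
def Homotopic : HomRel (DGModule A) := fun M N f g =>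
  ∃ s : M.carrier →ₗ[A.carrierᵐᵒᵖ] N.carrier,
    (∀ (i : ℤ) (x : M.carrier), x ∈ M.gr i → s x ∈ N.gr (i - 1)) ∧
    ∀ x : M.carrier, f.toFun x - g.toFun x = s (M.d x) + N.d (s x)

instance : Congruence (Homotopic (A := A)) where
  equivalence :=
    { refl := fun f => ⟨0, fun i x _ => (zero_mem _), fun x => by simp⟩
      symm := by
        rintro f g ⟨s, hs, h⟩
        refine ⟨-s, fun i x hx => neg_mem (hs i x hx), fun x => ?_⟩
        rw [← neg_sub, h]
        simp [add_comm]
      trans := by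
        rintro f g l ⟨s, hs, h⟩ ⟨t, ht, h'⟩
        refine ⟨s + t, fun i x hx => add_mem (hs i x hx) (ht i x hx), fun x => ?_⟩
        rw [← sub_add_sub_cancel (f.toFun x) (g.toFun x), h, h']
        simp only [LinearMap.add_apply, map_add]
        abel }
  comp_left := by
    rintro M N P f g g' ⟨s, hs, h⟩
    refine ⟨s ∘ₗ f.toFun, fun i x hx => hs i _ (f.map_mem i x hx), fun x => ?_⟩
    simp [h, f.map_d]
  comp_right := by
    rintro M N P f f' g ⟨s, hs, h⟩
    refine ⟨g.toFun ∘ₗ s, fun i x hx => g.map_mem _ _ (hs i x hx), fun x => ?_⟩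
    simp only [comp_toFun, LinearMap.comp_apply, ← map_sub, h, map_add, g.map_d]

lemma cohomology_map_eq_of_homotopic {M N : DGModule A} {f g : M ⟶ N} (h : Homotopic f g)
    (n : ℤ) : (cohomology A n).map f = (cohomology A n).map g := by
  obtain ⟨s, hs, h⟩ := h
  ext x
  obtain ⟨x, rfl⟩ := QuotientAddGroup.mk_surjective x
  change (QuotientAddGroup.mk (cocyclesMap f n x) : N.H n) =
    QuotientAddGroup.mk (cocyclesMap g n x)
  refine (QuotientAddGroup.eq_iff_sub_mem).2 ?_
  refine ⟨s x, hs n x x.2.1, ?_⟩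
  have hx : M.d x = 0 := x.2.2
  have := h x
  rw [hx, map_zero, zero_add] at this
  exact this.symm

/-! ### The shift -/

/-- The shift `M[n]`: `M[n]^i = M^{i+n}` with differential `(-1)^n d` and the same right action. -/
def shiftObj (M : DGModule A) (n : ℤ) : DGModule A where
  carrier := M.carrier
  gr i := M.gr (i + n)
  gr_indep := M.gr_indep.comp (add_left_injective n)
  gr_span := by
    rw [← M.gr_span]
    exact (Equiv.addRight n).iSup_comp (g := M.gr)
  smul_mem i j x a hx ha := by
    rw [show i + j + n = (i + n) + j by ring]
    exact M.smul_mem _ _ _ _ hx ha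
  d := n.negOnePow • M.d
  d_mem i x hx := by
    have h := M.d_mem _ x hx
    rw [show i + n + 1 = i + 1 + n by ring] at h
    exact zsmul_mem h (n.negOnePow : ℤ)
  d_d x := by simp [Units.smul_def, M.d_d]
  leibniz i x a hx := by
    have h := M.leibniz _ x a hx
    simp only [AddMonoidHom.smul_apply, h, smul_add, Int.negOnePow_add, Units.smul_def,
      Units.val_mul, smul_smul, ← mul_assoc, smul_comm (op a) ((n.negOnePow : ℤˣ) : ℤ)]
    congr 2
    rw [mul_comm ((n.negOnePow : ℤˣ) : ℤ), mul_assoc, ← Units.val_mul, Int.units_mul_self,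
      Units.val_one, mul_one]

/-- The shift functor `M ↦ M[n]`. -/
def shiftFun (A : DGAlgebra.{v, u} k) (n : ℤ) : DGModule A ⥤ DGModule A where
  obj M := M.shiftObj n
  map {M N} f := Hom.mk (M := M.shiftObj n) (N := N.shiftObj n) f.toFun
    (fun i x hx => f.map_mem (i + n) x hx)
    (fun (x : M.carrier) => by
      change f.toFun (n.negOnePow • M.d x) = n.negOnePow • N.d (f.toFun x)
      rw [Units.smul_def, map_zsmul, f.map_d, Units.smul_def])

/-- An isomorphism of dg-modules whose underlying linear map is a given linear equivalence. -/
def isoMk {M N : DGModule A} (e : M.carrier ≃ₗ[A.carrierᵐᵒᵖ] N.carrier)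
    (h : ∀ (i : ℤ) (x : M.carrier), x ∈ M.gr i → e x ∈ N.gr i)
    (h' : ∀ (i : ℤ) (x : N.carrier), x ∈ N.gr i → e.symm x ∈ M.gr i)
    (hd : ∀ x, e (M.d x) = N.d (e x)) : M ≅ N where
  hom := ⟨e.toLinearMap, h, hd⟩
  inv := ⟨e.symm.toLinearMap, h', fun x => e.injective (by simp [hd])⟩
  hom_inv_id := hom_ext fun x => e.symm_apply_apply x
  inv_hom_id := hom_ext fun x => e.apply_symm_apply x

/-- `M[0] ≅ M`, the identity on underlying modules. -/
def shiftZeroIso (M : DGModule A) : M.shiftObj 0 ≅ M :=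
  isoMk (M := M.shiftObj 0) (LinearEquiv.refl _ M.carrier)
    (fun i x hx => by
      have h : x ∈ M.gr (i + 0) := hx
      rwa [add_zero] at h)
    (fun i x hx => by
      change x ∈ M.gr (i + 0)
      rwa [add_zero])
    (fun x => by
      change (0 : ℤ).negOnePow • M.d x = M.d x
      simp)

/-- `M[a + b] ≅ M[a][b]`, the identity on underlying modules. -/
def shiftAddIso (M : DGModule A) (a b : ℤ) : M.shiftObj (a + b) ≅ (M.shiftObj a).shiftObj b :=
  isoMk (M := M.shiftObj (a + b)) (N := (M.shiftObj a).shiftObj b)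
    (LinearEquiv.refl _ M.carrier)
    (fun i x hx => by
      have h : x ∈ M.gr (i + (a + b)) := hx
      change x ∈ M.gr (i + b + a)
      rwa [show i + b + a = i + (a + b) by ring])
    (fun i x hx => by
      have h : x ∈ M.gr (i + b + a) := hx
      change x ∈ M.gr (i + (a + b))
      rwa [show i + (a + b) = i + b + a by ring])
    (fun x => by
      change (a + b).negOnePow • M.d x = b.negOnePow • (a.negOnePow • M.d x)
      rw [smul_smul, Int.negOnePow_add, mul_comm])

lemma eqToHom_shift_toFun (M : DGModule A) {a b : ℤ} (h : a = b) (x : M.carrier) :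
    Hom.toFun (eqToHom (show M.shiftObj a = M.shiftObj b by rw [h])) x = (x : M.carrier) := by
  subst h
  rfl

instance : HasShift (DGModule A) ℤ := hasShiftMk _ _
  { F := shiftFun A
    zero := NatIso.ofComponents shiftZeroIso (fun _ => rfl)
    add := fun a b => NatIso.ofComponents (fun M => M.shiftAddIso a b) (fun _ => rfl)
    assoc_hom_app := fun a b c M => by
      refine hom_ext fun x => ?_
      exact (eqToHom_shift_toFun M (add_assoc a b c) x).symm
    zero_add_hom_app := fun n M => by
      refine hom_ext fun x => ?_
      exact (eqToHom_shift_toFun M (zero_add n) x).symm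
    add_zero_hom_app := fun n M => by
      refine hom_ext fun x => ?_
      exact (eqToHom_shift_toFun M (add_zero n) x).symm }

/-! ### Mapping cones -/

/-- The mapping cone of `f : M ⟶ N`: the graded module `N ⊕ M[1]` with differential
`(y, x) ↦ (d y + f x, - d x)`. -/
def cone {M N : DGModule A} (f : M ⟶ N) : DGModule A where
  carrier := N.carrier × M.carrier
  gr i := (N.gr i).prod (M.gr (i + 1))
  gr_indep := by
    intro i
    have hN := N.gr_indep i
    have hM := (M.gr_indep.comp (add_left_injective (1 : ℤ))) i
    rw [AddSubgroup.disjoint_def] at hN hM ⊢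
    have hle : (⨆ j, ⨆ (_ : j ≠ i), (N.gr j).prod (M.gr (j + 1))) ≤
        (⨆ j, ⨆ (_ : j ≠ i), N.gr j).prod
          (⨆ j, ⨆ (_ : j ≠ i), (M.gr ∘ fun x => x + 1) j) :=
      iSup₂_le fun j hj => AddSubgroup.prod_mono
        (le_iSup₂_of_le (f := fun j (_ : j ≠ i) => N.gr j) j hj le_rfl)
        (le_iSup₂_of_le (f := fun j (_ : j ≠ i) => (M.gr ∘ fun x => x + 1) j) j hj le_rfl)
    intro x hx hx'
    have h := hle hx'
    exact Prod.ext (hN hx.1 h.1) (hM hx.2 h.2)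
  gr_span := by
    have hM : ⨆ i, M.gr (i + 1) = ⊤ := by
      rw [← M.gr_span]
      exact (Equiv.addRight (1 : ℤ)).iSup_comp (g := M.gr)
    have h₁ : (⊤ : AddSubgroup N.carrier) ≤
        (⨆ i, (N.gr i).prod (M.gr (i + 1))).comap (AddMonoidHom.inl _ _) := by
      rw [← N.gr_span]
      exact iSup_le fun i y hy => AddSubgroup.mem_iSup_of_mem i ⟨hy, zero_mem _⟩
    have h₂ : (⊤ : AddSubgroup M.carrier) ≤
        (⨆ i, (N.gr i).prod (M.gr (i + 1))).comap (AddMonoidHom.inr _ _) := by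
      rw [← hM]
      exact iSup_le fun i y hy => AddSubgroup.mem_iSup_of_mem i ⟨zero_mem _, hy⟩
    refine eq_top_iff.2 fun x _ => ?_
    have h : (x.1, (0 : M.carrier)) + ((0 : N.carrier), x.2) ∈
        ⨆ i, (N.gr i).prod (M.gr (i + 1)) :=
      add_mem (h₁ (AddSubgroup.mem_top x.1)) (h₂ (AddSubgroup.mem_top x.2))
    have hx : (x.1, (0 : M.carrier)) + ((0 : N.carrier), x.2) = x := by simp
    exact hx ▸ h
  smul_mem i j x a hx ha := ⟨N.smul_mem i j _ _ hx.1 ha, by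
    rw [show i + j + 1 = (i + 1) + j by ring]
    exact M.smul_mem _ _ _ _ hx.2 ha⟩
  d := ((N.d.comp (AddMonoidHom.fst _ _)) +
    (f.toFun.toAddMonoidHom.comp (AddMonoidHom.snd _ _))).prod
      (-(M.d.comp (AddMonoidHom.snd _ _)))
  d_mem i x hx := ⟨add_mem (N.d_mem _ _ hx.1) (f.map_mem _ _ hx.2),
    neg_mem (M.d_mem _ _ hx.2)⟩
  d_d x := by
    have h := f.map_d x.2
    ext <;> simp [N.d_d, M.d_d, h]
  leibniz i x a hx := by
    have h₁ := N.leibniz i x.1 a hx.1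
    have h₂ := M.leibniz (i + 1) x.2 a hx.2
    ext
    · simp [h₁]
      abel
    · simp [h₂, Int.negOnePow_succ]
      abel

/-- The triangle `M ⟶ N ⟶ cone f ⟶ M[1]` of dg-modules attached to `f : M ⟶ N`. -/
def coneTriangle {M N : DGModule A} (f : M ⟶ N) : Triangle (DGModule A) :=
  Triangle.mk (Z := cone f) f
    (Hom.mk (N := cone f) (LinearMap.inl _ N.carrier M.carrier) (fun _ _ hy => ⟨hy, zero_mem _⟩)
      (fun y => by
        refine Prod.ext ?_ ?_
        · change N.d y = N.d y + f.toFun 0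
          rw [map_zero, add_zero]
        · change 0 = - M.d 0
          rw [map_zero, neg_zero]))
    (Hom.mk (M := cone f) (N := M.shiftObj 1) (LinearMap.snd _ N.carrier M.carrier) (fun _ _ hx => hx.2)
      (fun x => by
        change - M.d x.2 = (1 : ℤ).negOnePow • M.d x.2
        simp))

end DGModule

/-! ### The homotopy category and the derived category -/

section Derived

open DGModule

variable (A : DGAlgebra.{v, u} k)

/-- The homotopy category of dg-modules over `A`. -/
abbrev HtpCat : Type (u + 1) := CategoryTheory.Quotient (Homotopic (A := A))

/-- The cohomology functors on the homotopy category. -/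
def HtpCat.cohomology (n : ℤ) : HtpCat A ⥤ AddCommGrpCat.{u} :=
  CategoryTheory.Quotient.lift _ (DGModule.cohomology A n)
    (fun _ _ _ _ h => cohomology_map_eq_of_homotopic h n)

/-- The quasi-isomorphisms in the homotopy category: the morphisms inducing isomorphisms in all
cohomologies. -/
def quasiIso : MorphismProperty (HtpCat A) :=
  fun _ _ f => ∀ n : ℤ, IsIso ((HtpCat.cohomology A n).map f)

instance : (Homotopic (A := A)).IsCompatibleWithShift ℤ where
  condition := by
    rintro n M N f g ⟨s, hs, h⟩
    refine ⟨LinearMap.mk (M := M.carrier) (M₂ := N.carrier)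
      ((n.negOnePow • s.toAddMonoidHom : M.carrier →+ N.carrier) : AddHom _ _)
      (fun a x => ?_), fun i x hx => ?_, fun (x : M.carrier) => ?_⟩
    · change n.negOnePow • s (a • x) = a • (n.negOnePow • s x)
      rw [map_smul, Units.smul_def, Units.smul_def, smul_comm]
    · have h' := hs _ x hx
      rw [show i + n - 1 = i - 1 + n by ring] at h'
      exact zsmul_mem h' (n.negOnePow : ℤ)
    · change f.toFun x - g.toFun x =
        n.negOnePow • s (n.negOnePow • M.d x) + n.negOnePow • N.d (n.negOnePow • s x)
      rw [h]
      simp only [Units.smul_def, map_zsmul, smul_smul, ← Units.val_mul, Int.units_mul_self,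
        Units.val_one, one_smul]

lemma HMap_bijective_iff {A : DGAlgebra.{v, u} k} {M N : DGModule A} (f : M ⟶ N) (n : ℤ) :
    Function.Bijective (HMap f n) ↔
      (∀ x ∈ M.cocycles n, f.toFun x ∈ N.coboundaries n → x ∈ M.coboundaries n) ∧
      (∀ y ∈ N.cocycles n, ∃ x ∈ M.cocycles n, y - f.toFun x ∈ N.coboundaries n) := by
  refine and_congr ?_ ?_
  · rw [injective_iff_map_eq_zero]
    constructor
    · intro h x hx hfx
      exact (QuotientAddGroup.eq_zero_iff (⟨x, hx⟩ : M.cocycles n)).1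
        (h (QuotientAddGroup.mk ⟨x, hx⟩)
          ((QuotientAddGroup.eq_zero_iff (cocyclesMap f n ⟨x, hx⟩)).2 hfx))
    · intro h x hx
      obtain ⟨x, rfl⟩ := QuotientAddGroup.mk_surjective x
      exact (QuotientAddGroup.eq_zero_iff x).2 (h x x.2
        ((QuotientAddGroup.eq_zero_iff (cocyclesMap f n x)).1 hx))
  · constructor
    · intro h y hy
      obtain ⟨x, hx⟩ := h (QuotientAddGroup.mk ⟨y, hy⟩)
      obtain ⟨x, rfl⟩ := QuotientAddGroup.mk_surjective x
      have hx' : (QuotientAddGroup.mk ⟨y, hy⟩ : N.H n) =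
        QuotientAddGroup.mk (cocyclesMap f n x) := hx.symm
      exact ⟨x, x.2, (QuotientAddGroup.eq_iff_sub_mem (x := (⟨y, hy⟩ : N.cocycles n))
        (y := cocyclesMap f n x)).1 hx'⟩
    · intro h y
      obtain ⟨y, rfl⟩ := QuotientAddGroup.mk_surjective y
      obtain ⟨x, hx, hxy⟩ := h y y.2
      refine ⟨QuotientAddGroup.mk ⟨x, hx⟩, Eq.symm ?_⟩
      exact (QuotientAddGroup.eq_iff_sub_mem (x := y)
        (y := cocyclesMap f n ⟨x, hx⟩)).2 hxy

lemma quasiIso_functor_map_iff {A : DGAlgebra.{v, u} k} {M N : DGModule A} (f : M ⟶ N) :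
    quasiIso A ((Quotient.functor Homotopic).map f) ↔
      ∀ n : ℤ, Function.Bijective (HMap f n) :=
  forall_congr' fun n => ConcreteCategory.isIso_iff_bijective ((DGModule.cohomology A n).map f)

lemma mem_cocycles_shift {A : DGAlgebra.{v, u} k} (M : DGModule A) (a n : ℤ) (x : M.carrier) :
    x ∈ (M.shiftObj a).cocycles n ↔ x ∈ M.cocycles (n + a) := by
  refine and_congr Iff.rfl ?_
  change a.negOnePow • M.d x = 0 ↔ M.d x = 0
  exact smul_eq_zero_iff_eq _

lemma mem_coboundaries_shift {A : DGAlgebra.{v, u} k} (M : DGModule A) (a n : ℤ)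
    (x : M.carrier) :
    x ∈ (M.shiftObj a).coboundaries n ↔ x ∈ M.coboundaries (n + a) := by
  have e : n - 1 + a = n + a - 1 := by ring
  constructor
  · rintro ⟨y, hy, rfl⟩
    have hy' : y ∈ M.gr (n - 1 + a) := hy
    refine ⟨(a.negOnePow : ℤ) • y, zsmul_mem (e ▸ hy') _, ?_⟩
    exact map_zsmul M.d _ y
  · rintro ⟨y, hy, rfl⟩
    have hy' : y ∈ M.gr (n - 1 + a) := by rw [e]; exact hy
    refine ⟨(a.negOnePow : ℤ) • y, zsmul_mem (K := M.gr (n - 1 + a)) hy' _, ?_⟩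
    change a.negOnePow • M.d ((a.negOnePow : ℤ) • y) = M.d y
    rw [map_zsmul, ← Units.smul_def, smul_smul, Int.units_mul_self, one_smul]

lemma HMap_shift_bijective_iff {A : DGAlgebra.{v, u} k} {M N : DGModule A} (f : M ⟶ N)
    (a n : ℤ) :
    Function.Bijective (HMap ((shiftFun A a).map f) n) ↔
      Function.Bijective (HMap f (n + a)) := by
  rw [HMap_bijective_iff, HMap_bijective_iff]
  refine and_congr (forall_congr' fun (x : M.carrier) => ?_)
    (forall_congr' fun (y : N.carrier) => ?_)
  · exact imp_congr (mem_cocycles_shift M a n x)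
      (imp_congr (mem_coboundaries_shift N a n (f.toFun x)) (mem_coboundaries_shift M a n x))
  · exact imp_congr (mem_cocycles_shift N a n y)
      (exists_congr fun (x : M.carrier) => and_congr (mem_cocycles_shift M a n x)
        (mem_coboundaries_shift N a n (y - f.toFun x)))

instance : (quasiIso A).IsCompatibleWithShift ℤ where
  condition a := by
    ext ⟨M⟩ ⟨N⟩ f
    obtain ⟨f, rfl⟩ := (Quotient.functor (Homotopic (A := A))).map_surjective f
    have h : quasiIso A (((Quotient.functor (Homotopic (A := A))).map f)⟦a⟧') ↔
        quasiIso A ((Quotient.functor (Homotopic (A := A))).map (f⟦a⟧')) :=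
      forall_congr' fun n => (MorphismProperty.isomorphisms _).arrow_mk_iso_iff
        ((HtpCat.cohomology A n).mapArrow.mapIso
          (((Functor.mapArrowFunctor _ _).mapIso
            ((Quotient.functor (Homotopic (A := A))).commShiftIso a)).app (Arrow.mk f)).symm)
    refine h.trans ?_
    rw [quasiIso_functor_map_iff, quasiIso_functor_map_iff]
    refine (forall_congr' fun n => HMap_shift_bijective_iff f a n).trans ?_
    exact ⟨fun h n => by have h' := h (n - a); rwa [sub_add_cancel] at h', fun h n => h (n + a)⟩

/-- The derived category of `A`: the localization of the homotopy category at the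
quasi-isomorphisms. -/
abbrev Der := (quasiIso A).Localization

/-- The canonical functor from dg-modules to the derived category. -/
abbrev toDer : DGModule A ⥤ Der A := Quotient.functor Homotopic ⋙ (quasiIso A).Q

/-- The distinguished triangles of the derived category: those isomorphic to the image of the
triangle `M ⟶ N ⟶ cone f ⟶ M[1]` of some morphism `f : M ⟶ N` of dg-modules. -/
def distTriangles : Set (Triangle (Der A)) :=
  {T | ∃ (M N : DGModule A) (f : M ⟶ N),
    Nonempty (T ≅ (toDer A).mapTriangle.obj (coneTriangle f))}

/-- `A` as a right dg-module over itself. -/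
def DGAlgebra.selfModule : DGModule A where
  carrier := A.carrier
  gr i := (A.gr i).toAddSubgroup
  gr_indep := by
    intro i
    have h := A.gr_indep i
    rw [Submodule.disjoint_def] at h
    rw [AddSubgroup.disjoint_def]
    have hle : (⨆ j, ⨆ (_ : j ≠ i), (A.gr j).toAddSubgroup) ≤
        (⨆ j, ⨆ (_ : j ≠ i), A.gr j).toAddSubgroup :=
      iSup₂_le fun j hj => Submodule.toAddSubgroup_mono
        (le_iSup₂_of_le (f := fun j (_ : j ≠ i) => A.gr j) j hj le_rfl)
    intro x hx hx'
    exact h x hx (hle hx')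
  gr_span := by
    refine eq_top_iff.2 fun x _ => ?_
    have hx : x ∈ ⨆ i, A.gr i := by rw [A.gr_span]; trivial
    induction hx using Submodule.iSup_induction' with
    | mem i y hy =>
      exact AddSubgroup.mem_iSup_of_mem (S := fun i => (A.gr i).toAddSubgroup) i hy
    | zero => exact zero_mem _
    | add y z _ _ hy hz => exact add_mem (hy trivial) (hz trivial)
  smul_mem i j x a hx ha := A.mul_mem i j x a hx ha
  d := A.d.toAddMonoidHom
  d_mem := A.d_mem
  d_d := A.d_d
  leibniz i x a hx := A.leibniz i x a hx

/-- `A` as an object of its derived category. -/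
def DGAlgebra.inDer : Der A := (toDer A).obj A.selfModule

/-! ### Direct summands of direct sums, resolution and coresolution dimension -/

variable {A}

/-- `Add U`: the direct summands of arbitrary (set-indexed) coproducts of copies of `U` in the
derived category. -/
def AddClosure (U : Der A) : ObjectProperty (Der A) := fun X =>
  ∃ (I : Type u) (c : Cofan (fun _ : I => U)),
    Nonempty (IsColimit c) ∧ Nonempty (Retract X c.pt)

/-- `add U`: the direct summands of finite coproducts of copies of `U` in the derived category. -/
def addClosure (U : Der A) : ObjectProperty (Der A) := fun X =>
  ∃ (I : Type u) (_ : Finite I) (c : Cofan (fun _ : I => U)),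
    Nonempty (IsColimit c) ∧ Nonempty (Retract X c.pt)

/-- `X ⟶ Y ⟶ Z` can be completed to a distinguished triangle `X ⟶ Y ⟶ Z ⟶ X[1]`. -/
def IsTriangle (X Y Z : Der A) : Prop :=
  ∃ (f : X ⟶ Y) (g : Y ⟶ Z) (h : Z ⟶ X⟦(1 : ℤ)⟧), Triangle.mk f g h ∈ distTriangles A

/-- A resolution of `X` of length `n` by objects in `P`: triangles
`Y (i+1) ⟶ C i ⟶ Y i ⟶` for `0 ≤ i ≤ n`, with `C i` in `P`, `Y 0 = X` and `Y (n+1) = 0`. -/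
structure IsResolution (P : ObjectProperty (Der A)) (X : Der A) (n : ℕ) (Y C : ℕ → Der A) :
    Prop where
  start : Nonempty (Y 0 ≅ X)
  mem : ∀ i ≤ n, P (C i)
  triangle : ∀ i ≤ n, IsTriangle (Y (i + 1)) (C i) (Y i)
  isZero : IsZero (Y (n + 1))

/-- A coresolution of `X` of length `n` by objects in `P`: triangles
`Y i ⟶ C i ⟶ Y (i+1) ⟶` for `0 ≤ i ≤ n`, with `C i` in `P`, `Y 0 = X` and `Y (n+1) = 0`. -/
structure IsCoresolution (P : ObjectProperty (Der A)) (X : Der A) (n : ℕ) (Y C : ℕ → Der A) :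
    Prop where
  start : Nonempty (Y 0 ≅ X)
  mem : ∀ i ≤ n, P (C i)
  triangle : ∀ i ≤ n, IsTriangle (Y i) (C i) (Y (i + 1))
  isZero : IsZero (Y (n + 1))

/-- `dim_P X ≤ n`. -/
def DimLE (P : ObjectProperty (Der A)) (X : Der A) (n : ℕ) : Prop :=
  ∃ Y C : ℕ → Der A, IsResolution P X n Y C

/-- `codim_P X ≤ n`. -/
def CodimLE (P : ObjectProperty (Der A)) (X : Der A) (n : ℕ) : Prop :=
  ∃ Y C : ℕ → Der A, IsCoresolution P X n Y C

/-! ### Silting objects -/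

/-- Silting objects: `dim_{Add A} U < ∞`; `Hom(U, U^(I)[i]) = 0` for every set `I` and every
`i > 0`; `codim_{Add U} A < ∞`. (A hom-set of the derived category is an abelian group, so it is
zero exactly if it is a subsingleton.) -/
structure IsSilting (U : Der A) : Prop where
  dim_finite : ∃ n : ℕ, DimLE (AddClosure A.inDer) U n
  orthogonal : ∀ (I : Type u) (c : Cofan (fun _ : I => U)), Nonempty (IsColimit c) →
    ∀ i : ℤ, 0 < i → Subsingleton (U ⟶ c.pt⟦i⟧)
  codim_finite : ∃ n : ℕ, CodimLE (AddClosure U) A.inDer n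

/-- Good silting objects: silting objects with `codim_{add U} A < ∞`. -/
structure IsGoodSilting (U : Der A) : Prop extends IsSilting U where
  codim_add_finite : ∃ n : ℕ, CodimLE (addClosure U) A.inDer n

/-- `n`-silting objects, described by `codim_{Add U} A ≤ n`. -/
structure IsNSilting (n : ℕ) (U : Der A) : Prop extends IsSilting U where
  codimLE : CodimLE (AddClosure U) A.inDer n

/-- `n`-silting objects, described by `dim_{Add A} U ≤ n`. -/
structure IsNSilting' (n : ℕ) (U : Der A) : Prop extends IsSilting U where
  dimLE : DimLE (AddClosure A.inDer) U n

/-- Two silting objects `U`, `U'` are equivalent if `Add U = Add U'`. -/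
def SiltingEquivalent (U U' : Der A) : Prop := AddClosure U = AddClosure U'

end Derived

end

/-!
The good silting object is a copower `W = U^(J)` of `U` over a large index set `J ≃ ℕ × J`.

A copower has the same `Add` as `U`, its orthogonality and its coresolution dimension are those of
`U`, and `dim_{Add A} W ≤ n` whenever `dim_{Add A} U ≤ n`, because copowers of distinguished
triangles are distinguished (`IsTriangle.copower`). So the content lies in realizing `W` as the sum
of the terms of a coresolution. A coresolution of `A` by `Add U` with terms `C₀, …, Cₙ` is
prolonged by two copies of `W`, by means of the triangles `0 ⟶ W ⟶ W` and `W ⟶ W ⟶ 0`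
(`IsCoresolution.prolong`). If `J` is large enough, each `Cᵢ` is a retract of `W`, so this is a
coresolution by `add W`. Since `W` is its own countable copower, the Eilenberg swindle
(`exists_isColimit_binaryCofan_of_retract`) shows that `W` absorbs each of its retracts, hence
`C₀ ⨿ ⋯ ⨿ Cₙ ⨿ W ⨿ W ≅ W` (`exists_isColimit_cofan_of_retract`).

What is needed from the derived category is thus a preadditive structure and the existence of
copowers, computed by direct sums of dg-modules, with direct sums commuting with mapping cones; its
triangulated structure plays no role beyond that. Both follow from the calculus of right fractions
of quasi-isomorphisms in the homotopy category, which comes from homotopy pullbacks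
(`htpPullback`), and from the stability of quasi-isomorphisms under direct sums
(`Localization.nonempty_isColimit_cofan`).
-/

noncomputable section

/-! ### Localization with respect to a calculus of right fractions -/

/-- A category whose opposite is preadditive is preadditive. -/
abbrev preadditiveOfOpposite (D : Type*) [Category* D] [Preadditive Dᵒᵖ] : Preadditive D where
  homGroup X Y := (opEquiv (Opposite.op Y) (Opposite.op X)).symm.addCommGroup
  add_comp _ _ _ f f' g :=
    Quiver.Hom.op_inj (Preadditive.comp_add (C := Dᵒᵖ) _ _ _ g.op f.op f'.op)
  comp_add _ _ _ f g g' :=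
    Quiver.Hom.op_inj (Preadditive.add_comp (C := Dᵒᵖ) _ _ _ g.op g'.op f.op)

/-- The localization of a preadditive category with respect to a class of morphisms admitting a
right calculus of fractions is preadditive. -/
abbrev Localization.preadditiveOfRightCalculus {C D : Type*} [Category* C] [Category* D]
    [Preadditive C] (L : C ⥤ D) (W : MorphismProperty C) [L.IsLocalization W]
    [W.HasRightCalculusOfFractions] : Preadditive D :=
  letI : Preadditive Dᵒᵖ := CategoryTheory.Localization.preadditive L.op W.op
  preadditiveOfOpposite D

/-- If `W` has a right calculus of fractions and coproducts of morphisms of `W` are in `W`, then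
the localization functor with respect to `W` preserves coproducts. The cofan `c` need not be a
coproduct itself: by `hW` for identities, some coproduct maps to it by a morphism of `W`. -/
theorem Localization.nonempty_isColimit_cofan {C D : Type*} [Category* C] [Category* D]
    (L : C ⥤ D) (W : MorphismProperty C) [L.IsLocalization W] [W.HasRightCalculusOfFractions]
    {I : Type*} {X : I → C} (c : Cofan X)
    (hW : ∀ (X' : I → C) (s : ∀ i, X' i ⟶ X i), (∀ i, W (s i)) →
      ∃ (c' : Cofan X') (_ : IsColimit c') (S : c'.pt ⟶ c.pt),
        (∀ i, c'.inj i ≫ S = s i ≫ c.inj i) ∧ W S) :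
    Nonempty (IsColimit (Cofan.mk (L.obj c.pt) (fun i => L.map (c.inj i)))) := by
  have hL := CategoryTheory.Localization.inverts L W
  -- Morphisms out of `L.obj c.pt` glue: the denominators of right fractions `X i ⟵ X' i ⟶ N`
  -- sum up to a morphism of `W`.
  have key₁ : ∀ (Z : D) (g : ∀ i, L.obj (X i) ⟶ Z),
      ∃ h : L.obj c.pt ⟶ Z, ∀ i, L.map (c.inj i) ≫ h = g i := by
    intro Z g
    have := CategoryTheory.Localization.essSurj L W
    let e := L.objObjPreimageIso Z
    choose φ hφ using fun i => CategoryTheory.Localization.exists_rightFraction L W (g i ≫ e.inv)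
    obtain ⟨c', hc', S, hS, hWS⟩ := hW (fun i => (φ i).X') (fun i => (φ i).s) (fun i => (φ i).hs)
    have := hL _ hWS
    refine ⟨inv (L.map S) ≫ L.map (Cofan.IsColimit.desc hc' fun i => (φ i).f) ≫ e.hom,
      fun i => ?_⟩
    have := hL _ (φ i).hs
    rw [← cancel_epi (L.map (φ i).s), ← L.map_comp_assoc, ← hS, L.map_comp_assoc,
      IsIso.hom_inv_id_assoc, ← L.map_comp_assoc, Cofan.IsColimit.fac,
      ← cancel_mono e.inv, Category.assoc, Category.assoc, e.hom_inv_id, Category.comp_id,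
      hφ i, MorphismProperty.RightFraction.map_s_comp_map]
  have key₂ : ∀ (Z : D) (g h : L.obj c.pt ⟶ Z),
      (∀ i, L.map (c.inj i) ≫ g = L.map (c.inj i) ≫ h) → g = h := by
    intro Z g h hgh
    have := CategoryTheory.Localization.essSurj L W
    let e := L.objObjPreimageIso Z
    rw [← cancel_mono e.inv]
    replace hgh : ∀ i, L.map (c.inj i) ≫ g ≫ e.inv = L.map (c.inj i) ≫ h ≫ e.inv := fun i => by
      rw [reassoc_of% (hgh i)]
    generalize g ≫ e.inv = g at hgh ⊢
    generalize h ≫ e.inv = h at hgh ⊢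
    -- A common denominator `r` of `g` and `h`.
    obtain ⟨φ, hφ⟩ := CategoryTheory.Localization.exists_rightFraction L W g
    obtain ⟨ψ, hψ⟩ := CategoryTheory.Localization.exists_rightFraction L W (L.map φ.s ≫ h)
    let r := ψ.s ≫ φ.s
    have hr : W r := W.comp_mem _ _ ψ.hs φ.hs
    have hrg : L.map r ≫ g = L.map (ψ.s ≫ φ.f) := by
      rw [L.map_comp, Category.assoc, hφ, MorphismProperty.RightFraction.map_s_comp_map,
        L.map_comp]
    have hrh : L.map r ≫ h = L.map ψ.f := by
      rw [L.map_comp, Category.assoc, hψ, MorphismProperty.RightFraction.map_s_comp_map]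
    choose ρ hρ using fun i =>
      (MorphismProperty.LeftFraction.mk (W := W) (c.inj i) r hr).exists_rightFraction
    dsimp only at hρ
    have h₂ : ∀ i, L.map ((ρ i).f ≫ ψ.s ≫ φ.f) = L.map ((ρ i).f ≫ ψ.f) := fun i => by
      rw [L.map_comp, ← hrg, L.map_comp _ ψ.f, ← hrh, ← L.map_comp_assoc, ← L.map_comp_assoc,
        ← hρ, L.map_comp_assoc, hgh, L.map_comp_assoc]
    choose X' t ht hte using fun i => (MorphismProperty.map_eq_iff_precomp L W _ _).1 (h₂ i)
    obtain ⟨c', hc', S, hS, hWS⟩ := hW X' (fun i => t i ≫ (ρ i).s)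
      (fun i => W.comp_mem _ _ (ht i) (ρ i).hs)
    let T := Cofan.IsColimit.desc hc' fun i => t i ≫ (ρ i).f
    have hT : T ≫ r = S := Cofan.IsColimit.hom_ext hc' _ _ fun i => by
      rw [← Category.assoc, Cofan.IsColimit.fac, hS, Category.assoc, Category.assoc, hρ]
    have hT' : T ≫ ψ.s ≫ φ.f = T ≫ ψ.f := Cofan.IsColimit.hom_ext hc' _ _ fun i => by
      rw [← Category.assoc, Cofan.IsColimit.fac, ← Category.assoc _ T, Cofan.IsColimit.fac,
        Category.assoc, Category.assoc, hte]
    have := hL _ hWS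
    rw [← cancel_epi (L.map S), ← hT, L.map_comp_assoc, hrg, L.map_comp_assoc, hrh,
      ← L.map_comp, hT', L.map_comp]
  exact ⟨Cofan.IsColimit.mk _ (fun t => (key₁ t.pt t.inj).choose)
    (fun t => (key₁ t.pt t.inj).choose_spec)
    (fun t m hm => key₂ _ _ _ fun i => (hm i).trans ((key₁ t.pt t.inj).choose_spec i).symm)⟩

/-! ### The Eilenberg swindle -/

/-- The Eilenberg swindle: if `X` is a retract of `V` and `W` is a countable coproduct of copies
of `V`, then `X ⨿ W ≅ W` (with `Y ≅ W` in place of the first `W`). No complement of `X` in `V` is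
needed: with `e : V ⟶ V` the idempotent attached to the retract, `W ⟶ W` maps the `n`-th copy of
`V` by `1 - e` to the `n`-th copy and by `e` to the next one, which leaves room for `X` in the
zeroth copy. -/
theorem exists_isColimit_binaryCofan_of_retract {D : Type*} [Category* D] [Preadditive D]
    {X V Y : D} (r : Retract X V) (w : Cofan fun _ : ℕ => V) (hw : IsColimit w) (φ : Y ≅ w.pt) :
    ∃ (a : X ⟶ w.pt) (b : Y ⟶ w.pt), Nonempty (IsColimit (BinaryCofan.mk a b)) := by
  obtain ⟨e, he⟩ : ∃ e : V ⟶ V, e = r.r ≫ r.i := ⟨_, rfl⟩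
  have hie : r.i ≫ e = r.i := by rw [he, ← Category.assoc, r.retract, Category.id_comp]
  have hee : e ≫ e = e := by simp [he]
  have h₁ : (𝟙 V - e) ≫ (𝟙 V - e) = 𝟙 V - e := by simp [hee]
  have h₂ : e ≫ (𝟙 V - e) = 0 := by simp [hee]
  have h₃ : (𝟙 V - e) ≫ e = 0 := by simp [hee]
  have h₄ : r.i ≫ (𝟙 V - e) = 0 := by simp [hie]
  have h₅ : (𝟙 V - e) ≫ r.r = 0 := by simp [he]
  obtain ⟨ι, hι⟩ : ∃ ι : ℕ → (V ⟶ w.pt), ι = w.inj := ⟨_, rfl⟩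
  have hext : ∀ {Z : D} (f g : w.pt ⟶ Z), (∀ n, ι n ≫ f = ι n ≫ g) → f = g :=
    fun f g h => Cofan.IsColimit.hom_ext hw f g (hι ▸ h)
  have hdesc : ∀ {Z : D} (f : ℕ → (V ⟶ Z)), ∃ g : w.pt ⟶ Z, ∀ n, ι n ≫ g = f n :=
    fun f => ⟨Cofan.IsColimit.desc hw f, hι ▸ Cofan.IsColimit.fac hw f⟩
  obtain ⟨b, hb⟩ := hdesc fun n => (𝟙 V - e) ≫ ι n + e ≫ ι (n + 1)
  have key : ∀ {Z : D} (f : X ⟶ Z) (g : w.pt ⟶ Z), ∃ d : w.pt ⟶ Z,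
      ((r.i ≫ ι 0) ≫ d = f ∧ b ≫ d = g) ∧
        ∀ m : w.pt ⟶ Z, (r.i ≫ ι 0) ≫ m = f → b ≫ m = g → m = d := by
    intro Z f g
    obtain ⟨d, hd⟩ := hdesc fun n => Nat.casesOn n (r.r ≫ f + (𝟙 V - e) ≫ ι 0 ≫ g)
      fun n => e ≫ ι n ≫ g + (𝟙 V - e) ≫ ι (n + 1) ≫ g
    have hd₀ : ι 0 ≫ d = r.r ≫ f + (𝟙 V - e) ≫ ι 0 ≫ g := hd 0
    have hd₁ : ∀ n, ι (n + 1) ≫ d = e ≫ ι n ≫ g + (𝟙 V - e) ≫ ι (n + 1) ≫ g :=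
      fun n => hd (n + 1)
    refine ⟨d, ⟨?_, hext _ _ fun n => ?_⟩, ?_⟩
    · rw [Category.assoc, hd₀, Preadditive.comp_add, reassoc_of% r.retract, reassoc_of% h₄,
        zero_comp, add_zero]
    · rw [← Category.assoc, hb, Preadditive.add_comp, Category.assoc, Category.assoc, hd₁]
      rcases n with - | n
      · rw [hd₀, Preadditive.comp_add, Preadditive.comp_add, reassoc_of% h₁, reassoc_of% h₅,
          reassoc_of% h₂, reassoc_of% hee]
        simp
      · rw [hd₁, Preadditive.comp_add, Preadditive.comp_add, reassoc_of% h₁, reassoc_of% h₃,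
          reassoc_of% h₂, reassoc_of% hee]
        simp
    · rintro m rfl rfl
      have hm : ∀ n, ι n ≫ b ≫ m = (𝟙 V - e) ≫ ι n ≫ m + e ≫ ι (n + 1) ≫ m := fun n => by
        rw [← Category.assoc, hb, Preadditive.add_comp, Category.assoc, Category.assoc]
      refine hext _ _ fun n => ?_
      rcases n with - | n
      · rw [hd₀, hm, Preadditive.comp_add, reassoc_of% h₁, reassoc_of% h₃, zero_comp,
          add_zero, Category.assoc, ← Category.assoc r.r, ← he]
        simp
      · rw [hd₁, hm, hm, Preadditive.comp_add, Preadditive.comp_add, reassoc_of% h₁,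
          reassoc_of% h₃, reassoc_of% h₂, reassoc_of% hee]
        simp
  have key' : ∀ {Z : D} (f : X ⟶ Z) (g : Y ⟶ Z), ∃ d : w.pt ⟶ Z,
      ((r.i ≫ ι 0) ≫ d = f ∧ (φ.hom ≫ b) ≫ d = g) ∧
        ∀ m : w.pt ⟶ Z, (r.i ≫ ι 0) ≫ m = f → (φ.hom ≫ b) ≫ m = g → m = d := by
    intro Z f g
    obtain ⟨d, ⟨hd₀, hd₁⟩, hd⟩ := key f (φ.inv ≫ g)
    refine ⟨d, ⟨hd₀, by rw [Category.assoc, hd₁, φ.hom_inv_id_assoc]⟩, fun m hm₀ hm₁ =>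
      hd m hm₀ ?_⟩
    rw [← hm₁, Category.assoc, φ.inv_hom_id_assoc]
  exact ⟨r.i ≫ ι 0, φ.hom ≫ b, ⟨BinaryCofan.isColimitMk (fun s => (key' s.inl s.inr).choose)
    (fun s => (key' s.inl s.inr).choose_spec.1.1) (fun s => (key' s.inl s.inr).choose_spec.1.2)
    (fun s m => (key' s.inl s.inr).choose_spec.2 m)⟩⟩

/-! ### Copowers -/

/-- A copower of a copower is a copower. -/
def Cofan.isColimitProd {D : Type*} [Category* D] {I J : Type*} {U : D}
    (c : Cofan fun _ : I => U) (hc : IsColimit c) (d : Cofan fun _ : J => c.pt)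
    (hd : IsColimit d) :
    IsColimit (Cofan.mk (f := fun _ : J × I => U) d.pt fun p => c.inj p.2 ≫ d.inj p.1) :=
  Cofan.IsColimit.mk _
    (fun t => Cofan.IsColimit.desc hd fun j => Cofan.IsColimit.desc hc fun i => t.inj (j, i))
    (fun t p => by
      rw [cofan_mk_inj, Category.assoc]
      erw [Cofan.IsColimit.fac, Cofan.IsColimit.fac])
    (fun t m hm => Cofan.IsColimit.hom_ext hd _ _ fun j => by
      rw [Cofan.IsColimit.fac]
      refine Cofan.IsColimit.hom_ext hc _ _ fun i => ?_
      erw [Cofan.IsColimit.fac]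
      rw [← hm (j, i), cofan_mk_inj, Category.assoc])

/-- The copower indexed by an equivalent type. -/
def Cofan.isColimitReindex {D : Type*} [Category* D] {I J : Type*} {U : D} (e : J ≃ I)
    (c : Cofan fun _ : I => U) (hc : IsColimit c) :
    IsColimit (Cofan.mk (f := fun _ : J => U) c.pt fun j => c.inj (e j)) :=
  Cofan.IsColimit.mk _
    (fun t => Cofan.IsColimit.desc hc fun i => t.inj (e.symm i))
    (fun t j => by
      rw [cofan_mk_inj, Cofan.IsColimit.fac, e.symm_apply_apply])
    (fun t m hm => Cofan.IsColimit.hom_ext hc _ _ fun i => by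
      rw [Cofan.IsColimit.fac, ← hm, cofan_mk_inj, e.apply_symm_apply])

/-- An object is its own copower indexed by a one-element type. -/
def Cofan.isColimitPUnit {D : Type*} [Category* D] (U : D) :
    IsColimit (Cofan.mk (f := fun _ : PUnit => U) U fun _ => 𝟙 U) :=
  Cofan.IsColimit.mk _ (fun t => t.inj PUnit.unit) (fun _ _ => Category.id_comp _)
    (fun _ m hm => (Category.id_comp m).symm.trans (hm PUnit.unit))

/-- Coproducts of retracts are retracts. -/
def Cofan.retract {D : Type*} [Category* D] {I : Type*} {X V : I → D}
    (r : ∀ i, Retract (X i) (V i)) (c : Cofan X) (hc : IsColimit c) (d : Cofan V)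
    (hd : IsColimit d) : Retract c.pt d.pt where
  i := Cofan.IsColimit.desc hc fun i => (r i).i ≫ d.inj i
  r := Cofan.IsColimit.desc hd fun i => (r i).r ≫ c.inj i
  retract := Cofan.IsColimit.hom_ext hc _ _ fun i => by
    rw [← Category.assoc, Cofan.IsColimit.fac, Category.assoc, Cofan.IsColimit.fac,
      Retract.retract_assoc, Category.comp_id]

/-- Copowers of isomorphic objects are isomorphic. -/
def Cofan.copowerIso {D : Type*} [Category* D] {I : Type*} {X Y : D} (e : X ≅ Y)
    (c : Cofan fun _ : I => X) (hc : IsColimit c) (d : Cofan fun _ : I => Y) (hd : IsColimit d) :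
    c.pt ≅ d.pt where
  hom := Cofan.IsColimit.desc hc fun i => e.hom ≫ d.inj i
  inv := Cofan.IsColimit.desc hd fun i => e.inv ≫ c.inj i
  hom_inv_id := (Cofan.retract (fun _ => Retract.ofIso e) c hc d hd).retract
  inv_hom_id := (Cofan.retract (fun _ => Retract.ofIso e.symm) d hd c hc).retract

/-- A copower of `U` is a retract of every copower of `U` over a larger index set. -/
def Cofan.retractOfInjective {D : Type*} [Category* D] [HasZeroMorphisms D] {I J : Type*} {U : D}
    (f : I → J) (hf : Function.Injective f) (c : Cofan fun _ : I => U) (hc : IsColimit c)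
    (d : Cofan fun _ : J => U) (hd : IsColimit d) : Retract c.pt d.pt where
  i := Cofan.IsColimit.desc hc fun i => d.inj (f i)
  r := Cofan.IsColimit.desc hd fun j =>
    open Classical in if h : ∃ i, f i = j then c.inj h.choose else 0
  retract := Cofan.IsColimit.hom_ext hc _ _ fun i => by
    have h : ∃ i', f i' = f i := ⟨i, rfl⟩
    rw [← Category.assoc, Cofan.IsColimit.fac, Cofan.IsColimit.fac, dif_pos h, Category.comp_id,
      hf h.choose_spec]

/-- If `W` is its own countable copower, then it absorbs any finite family of its retracts; the
last member of the family is `W` itself, so that there is something to be absorbed by. -/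
theorem exists_isColimit_cofan_of_retract {D : Type*} [Category* D] [Preadditive D] {W : D}
    (w : Cofan fun _ : ℕ => W) (hw : IsColimit w) (e : w.pt ≅ W) (n : ℕ) (X : Fin (n + 1) → D)
    (hX : ∀ i, Nonempty (Retract (X i) W)) (hl : X (Fin.last n) = W) :
    ∃ c : Cofan X, Nonempty (IsColimit c) ∧ Nonempty (c.pt ≅ W) := by
  induction n with
  | zero =>
    have h0 : ∀ i : Fin (0 + 1), i = 0 := fun i => Subsingleton.elim (α := Fin 1) i 0
    refine ⟨Cofan.mk (X 0) fun i => eqToHom (by rw [h0 i]),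
      ⟨Cofan.IsColimit.mk _ (fun t => t.inj 0) (fun t i => ?_) fun t m hm => ?_⟩,
      ⟨eqToIso hl⟩⟩
    · obtain rfl := h0 i
      simp
    · rw [← hm 0]
      simp
  | succ n ih =>
    obtain ⟨c, ⟨hc⟩, ⟨e'⟩⟩ := ih (fun i => X i.succ) (fun i => hX _) hl
    obtain ⟨a, b, ⟨h⟩⟩ :=
      exists_isColimit_binaryCofan_of_retract (hX 0).some w hw (e' ≪≫ e.symm)
    exact ⟨_, ⟨extendCofanIsColimit X hc h⟩, ⟨e⟩⟩

namespace DGModule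

variable {k : Type v} [CommRing k] {A : DGAlgebra.{v, u} k}

/-! ### Additive structure on dg-modules and on the homotopy category -/

instance (M N : DGModule A) : AddCommGroup (M ⟶ N) :=
  letI : Zero (M ⟶ N) := ⟨⟨0, fun _ _ _ => zero_mem _, fun _ => by simp⟩⟩
  letI : Add (M ⟶ N) := ⟨fun f g => ⟨f.toFun + g.toFun,
    fun i x hx => add_mem (f.map_mem i x hx) (g.map_mem i x hx),
    fun x => by simp [f.map_d, g.map_d]⟩⟩
  letI : Neg (M ⟶ N) := ⟨fun f => ⟨-f.toFun, fun i x hx => neg_mem (f.map_mem i x hx),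
    fun x => by simp [f.map_d]⟩⟩
  { add_assoc := fun _ _ _ => hom_ext fun _ => add_assoc _ _ _
    zero_add := fun _ => hom_ext fun _ => zero_add _
    add_zero := fun _ => hom_ext fun _ => add_zero _
    add_comm := fun _ _ => hom_ext fun _ => add_comm _ _
    neg_add_cancel := fun _ => hom_ext fun _ => neg_add_cancel _
    nsmul := nsmulRec
    zsmul := zsmulRec }

lemma add_toFun {M N : DGModule A} (f g : M ⟶ N) (x : M.carrier) :
    Hom.toFun (f + g) x = f.toFun x + g.toFun x := rfl

instance : Preadditive (DGModule A) where
  add_comp _ _ _ f f' g := hom_ext fun x => map_add g.toFun (f.toFun x) (f'.toFun x)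
  comp_add _ _ _ _ _ _ := rfl

instance : Preadditive (HtpCat A) :=
  Quotient.preadditive _ (by
    rintro M N f₁ f₂ g₁ g₂ ⟨s, hs, h⟩ ⟨t, ht, h'⟩
    refine ⟨s + t, fun i x hx => add_mem (hs i x hx) (ht i x hx), fun x => ?_⟩
    rw [add_toFun, add_toFun, add_sub_add_comm, h, h', LinearMap.add_apply, LinearMap.add_apply,
      map_add]
    abel)

/-! ### Direct sums of dg-modules -/

/-- The direct sum of a family of dg-modules: an element is homogeneous of degree `n` if all its
components are. -/
def directSum {I : Type u} (M : I → DGModule A) : DGModule A where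
  carrier := Π₀ i, (M i).carrier
  gr n := ⨅ i, ((M i).gr n).comap (DFinsupp.evalAddMonoidHom i)
  gr_indep := by
    intro n
    rw [AddSubgroup.disjoint_def]
    intro x hx hx'
    ext i
    have h := (M i).gr_indep n
    rw [AddSubgroup.disjoint_def] at h
    have hle : (⨆ m, ⨆ (_ : m ≠ n), ⨅ i, ((M i).gr m).comap (DFinsupp.evalAddMonoidHom i)) ≤
        (⨆ m, ⨆ (_ : m ≠ n), (M i).gr m).comap (DFinsupp.evalAddMonoidHom i) :=
      iSup₂_le fun m hm => (iInf_le _ i).trans (AddSubgroup.comap_mono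
        (le_iSup₂_of_le (f := fun m (_ : m ≠ n) => (M i).gr m) m hm le_rfl))
    exact h (AddSubgroup.mem_iInf.1 hx i) (hle hx')
  gr_span := by
    classical
    refine eq_top_iff.2 fun x _ => ?_
    induction x using DFinsupp.induction with
    | h0 => exact zero_mem _
    | ha i b f _ _ hf =>
      refine add_mem ?_ (hf trivial)
      have h : (⊤ : AddSubgroup (M i).carrier) ≤
          (⨆ n, ⨅ j, ((M j).gr n).comap (DFinsupp.evalAddMonoidHom j)).comap
            (DFinsupp.singleAddHom (fun i => (M i).carrier) i) := by
        rw [← (M i).gr_span]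
        refine iSup_le fun n y hy => AddSubgroup.mem_iSup_of_mem n
          (AddSubgroup.mem_iInf.2 fun j => ?_)
        change (DFinsupp.single i y : Π₀ i, (M i).carrier) j ∈ (M j).gr n
        by_cases hij : i = j
        · subst hij
          rwa [DFinsupp.single_eq_same]
        · rw [DFinsupp.single_eq_of_ne (Ne.symm hij)]
          exact zero_mem _
      exact h trivial
  smul_mem m n x a hx ha := AddSubgroup.mem_iInf.2 fun i =>
    (M i).smul_mem m n _ a (AddSubgroup.mem_iInf.1 hx i) ha
  d := DFinsupp.mapRange.addMonoidHom fun i => (M i).d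
  d_mem n x hx := AddSubgroup.mem_iInf.2 fun i => by
    change DFinsupp.mapRange (fun i => (M i).d) (fun i => map_zero _) x i ∈ (M i).gr (n + 1)
    rw [DFinsupp.mapRange_apply]
    exact (M i).d_mem n _ (AddSubgroup.mem_iInf.1 hx i)
  d_d x := by
    ext i
    simp [(M i).d_d]
  leibniz n x a hx := by
    ext i
    have h := (M i).leibniz n (x i) a (AddSubgroup.mem_iInf.1 hx i)
    simpa [Units.smul_def] using h

section DirectSum

variable {I : Type u} (M : I → DGModule A)

/-- The projection onto a summand. -/
def directSumπ (i : I) : directSum M ⟶ M i :=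
  Hom.mk (M := directSum M) (DFinsupp.lapply (R := A.carrierᵐᵒᵖ) (M := fun i => (M i).carrier) i)
    (fun _ _ hx => AddSubgroup.mem_iInf.1 hx i)
    (fun x => DFinsupp.mapRange_apply (fun i => (M i).d) (fun _ => map_zero _) x i)

lemma mem_directSum_gr (n : ℤ) (x : (directSum M).carrier) :
    x ∈ (directSum M).gr n ↔ ∀ i, (directSumπ M i).toFun x ∈ (M i).gr n :=
  AddSubgroup.mem_iInf

lemma directSum_ext {x y : (directSum M).carrier}
    (h : ∀ i, (directSumπ M i).toFun x = (directSumπ M i).toFun y) : x = y :=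
  DFinsupp.ext h

open Classical in
/-- The inclusion of a summand as a linear map. -/
def directSumSingle (i : I) : (M i).carrier →ₗ[A.carrierᵐᵒᵖ] (directSum M).carrier :=
  DFinsupp.lsingle (R := A.carrierᵐᵒᵖ) (M := fun i => (M i).carrier) i

lemma directSumπ_single_same (i : I) (x : (M i).carrier) :
    (directSumπ M i).toFun (directSumSingle M i x) = x := by
  classical
  exact DFinsupp.single_eq_same (β := fun i => (M i).carrier)

lemma directSumπ_single_of_ne {i j : I} (h : i ≠ j) (x : (M i).carrier) :
    (directSumπ M j).toFun (directSumSingle M i x) = 0 := by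
  classical
  exact DFinsupp.single_eq_of_ne (β := fun i => (M i).carrier) h.symm

/-- The inclusion of a summand. -/
def directSumι (i : I) : M i ⟶ directSum M where
  toFun := directSumSingle M i
  map_mem n x hx := (mem_directSum_gr M n _).2 fun j => by
    by_cases hij : i = j
    · subst hij
      rwa [directSumπ_single_same]
    · rw [directSumπ_single_of_ne M hij]
      exact zero_mem _
  map_d x := directSum_ext M fun j => by
    rw [(directSumπ M j).map_d]
    by_cases hij : i = j
    · subst hij
      rw [directSumπ_single_same, directSumπ_single_same]
    · rw [directSumπ_single_of_ne M hij, directSumπ_single_of_ne M hij, map_zero]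

lemma directSumπ_ι_same (i : I) (x : (M i).carrier) :
    (directSumπ M i).toFun ((directSumι M i).toFun x) = x :=
  directSumπ_single_same M i x

lemma directSumπ_ι_of_ne {i j : I} (h : i ≠ j) (x : (M i).carrier) :
    (directSumπ M j).toFun ((directSumι M i).toFun x) = 0 :=
  directSumπ_single_of_ne M h x

open Classical in
/-- The linear map out of a direct sum given by its restrictions to the summands. -/
def directSumLift {N : Type*} [AddCommGroup N] [Module A.carrierᵐᵒᵖ N]
    (f : ∀ i, (M i).carrier →ₗ[A.carrierᵐᵒᵖ] N) : (directSum M).carrier →ₗ[A.carrierᵐᵒᵖ] N :=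
  DFinsupp.lsum (M := fun i => (M i).carrier) ℕ f

variable {M}

lemma directSumLift_ι {N : Type*} [AddCommGroup N] [Module A.carrierᵐᵒᵖ N]
    (f : ∀ i, (M i).carrier →ₗ[A.carrierᵐᵒᵖ] N) (i : I) (x : (M i).carrier) :
    directSumLift M f ((directSumι M i).toFun x) = f i x := by
  classical
  exact DFinsupp.lsum_single (M := fun i => (M i).carrier) ℕ f i x

/-- Additive maps out of a direct sum agree as soon as they do on the summands. -/
lemma directSum_addHom_ext {N : Type*} [AddCommGroup N] {f g : (directSum M).carrier →+ N}
    (h : ∀ i x, f ((directSumι M i).toFun x) = g ((directSumι M i).toFun x)) (x) : f x = g x := by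
  classical
  exact DFunLike.congr_fun
    (DFinsupp.addHom_ext (β := fun i => (M i).carrier) (f := f) (g := g) h) x

/-- A linear map out of a direct sum is homogeneous if its restrictions to the summands are. -/
lemma directSumLift_mem {N : Type*} [AddCommGroup N] [Module A.carrierᵐᵒᵖ N]
    (f : ∀ i, (M i).carrier →ₗ[A.carrierᵐᵒᵖ] N) (n : ℤ) (S : AddSubgroup N)
    (hf : ∀ i, ∀ x ∈ (M i).gr n, f i x ∈ S) (x) (hx : x ∈ (directSum M).gr n) :
    directSumLift M f x ∈ S := by
  classical
  have h : directSumLift M f x =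
      DFinsupp.sum (β := fun i => (M i).carrier) x fun i y => f i y :=
    (DFinsupp.lsum_apply_apply (M := fun i => (M i).carrier) ℕ f x).trans
      (DFinsupp.sumAddHom_apply _ _)
  rw [h]
  exact sum_mem fun i _ => hf i _ ((mem_directSum_gr M n x).1 hx i)

/-- The morphism out of a direct sum given by its restrictions to the summands. -/
def directSumDesc {N : DGModule A} (f : ∀ i, M i ⟶ N) : directSum M ⟶ N :=
  ⟨directSumLift M fun i => (f i).toFun,
    fun n x hx => directSumLift_mem _ n _ (fun i y hy => (f i).map_mem n y hy) x hx,
    directSum_addHom_ext (f := (directSumLift M fun i => (f i).toFun).toAddMonoidHom.comp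
        (directSum M).d) (g := N.d.comp (directSumLift M fun i => (f i).toFun).toAddMonoidHom)
      fun i x => by
        change directSumLift M (fun i => (f i).toFun) ((directSum M).d ((directSumι M i).toFun x)) =
          N.d (directSumLift M (fun i => (f i).toFun) ((directSumι M i).toFun x))
        rw [← (directSumι M i).map_d, directSumLift_ι, directSumLift_ι, (f i).map_d]⟩

lemma directSumι_desc {N : DGModule A} (f : ∀ i, M i ⟶ N) (i : I) :
    directSumι M i ≫ directSumDesc f = f i :=
  hom_ext fun x => directSumLift_ι (fun i => (f i).toFun) i x

/-- Homotopies on the summands add up to a homotopy on the direct sum. -/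
lemma homotopic_of_directSum {N : DGModule A} {f g : directSum M ⟶ N}
    (h : ∀ i, Homotopic (directSumι M i ≫ f) (directSumι M i ≫ g)) : Homotopic f g := by
  choose s hs hfg using h
  refine ⟨directSumLift M s, fun n x hx => directSumLift_mem s n _ (fun i => hs i n) x hx, ?_⟩
  refine directSum_addHom_ext
    (f := f.toFun.toAddMonoidHom - g.toFun.toAddMonoidHom)
    (g := (directSumLift M s).toAddMonoidHom.comp (directSum M).d +
      N.d.comp (directSumLift M s).toAddMonoidHom) fun i x => ?_
  change f.toFun ((directSumι M i).toFun x) - g.toFun ((directSumι M i).toFun x) =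
    directSumLift M s ((directSum M).d ((directSumι M i).toFun x)) +
      N.d (directSumLift M s ((directSumι M i).toFun x))
  rw [← (directSumι M i).map_d, directSumLift_ι, directSumLift_ι]
  exact hfg i x

/-- The componentwise morphism between direct sums. -/
def directSumMap {N : I → DGModule A} (f : ∀ i, M i ⟶ N i) : directSum M ⟶ directSum N :=
  directSumDesc fun i => f i ≫ directSumι N i

lemma directSumπ_lift_single {N : I → DGModule A}
    (g : ∀ i, (M i).carrier →ₗ[A.carrierᵐᵒᵖ] (N i).carrier) (x : (directSum M).carrier) (i : I) :
    (directSumπ N i).toFun (directSumLift M (fun i => directSumSingle N i ∘ₗ g i) x) =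
      g i ((directSumπ M i).toFun x) := by
  refine directSum_addHom_ext
    (f := (directSumπ N i).toFun.toAddMonoidHom.comp
      (directSumLift M fun i => directSumSingle N i ∘ₗ g i).toAddMonoidHom)
    (g := (g i).toAddMonoidHom.comp (directSumπ M i).toFun.toAddMonoidHom)
    (fun j y => ?_) x
  change (directSumπ N i).toFun (directSumLift M (fun i => directSumSingle N i ∘ₗ g i)
    ((directSumι M j).toFun y)) = g i ((directSumπ M i).toFun ((directSumι M j).toFun y))
  rw [directSumLift_ι, LinearMap.comp_apply]
  by_cases hij : j = i
  · subst hij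
    rw [directSumπ_single_same, directSumπ_ι_same]
  · rw [directSumπ_single_of_ne N hij, directSumπ_ι_of_ne M hij, map_zero]

lemma directSumπ_map {N : I → DGModule A} (f : ∀ i, M i ⟶ N i) (x : (directSum M).carrier)
    (i : I) :
    (directSumπ N i).toFun ((directSumMap f).toFun x) = (f i).toFun ((directSumπ M i).toFun x) :=
  directSumπ_lift_single (fun i => (f i).toFun) x i

/-- An element of a direct sum belongs to a subgroup if all its components do. -/
lemma directSum_mem (S : AddSubgroup (directSum M).carrier) (x : (directSum M).carrier)
    (h : ∀ i, (directSumι M i).toFun ((directSumπ M i).toFun x) ∈ S) : x ∈ S := by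
  classical
  have hx : x = DFinsupp.sum (β := fun i => (M i).carrier) x
      fun i y => DFinsupp.single i y :=
    (DFinsupp.sum_single (β := fun i => (M i).carrier) (f := x)).symm
  rw [hx]
  refine sum_mem fun i _ => ?_
  convert! h i

/-- A direct sum of quasi-isomorphisms is a quasi-isomorphism. -/
lemma HMap_directSumMap_bijective {N : I → DGModule A} (f : ∀ i, M i ⟶ N i) (n : ℤ)
    (hf : ∀ i, Function.Bijective (HMap (f i) n)) :
    Function.Bijective (HMap (directSumMap f) n) := by
  simp only [HMap_bijective_iff] at hf ⊢
  refine ⟨fun x hx hfx => directSum_mem _ _ fun i => map_coboundaries _ _ ?_, fun y hy => ?_⟩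
  · refine (hf i).1 _ (map_cocycles _ _ hx) ?_
    rw [← directSumπ_map]
    exact map_coboundaries _ _ hfx
  · have h : y ∈ ((directSum M).cocycles n).map (directSumMap f).toFun.toAddMonoidHom ⊔
        (directSum N).coboundaries n := by
      refine directSum_mem _ _ fun i => ?_
      obtain ⟨x, hx, hxy⟩ := (hf i).2 _ (map_cocycles (directSumπ N i) n hy)
      refine AddSubgroup.mem_sup.2 ⟨_, ⟨_, map_cocycles (directSumι M i) n hx, rfl⟩, _,
        map_coboundaries (directSumι N i) n hxy, ?_⟩
      rw [map_sub]
      have := congr_arg (fun g => Hom.toFun g x) (directSumι_desc (fun i => f i ≫ directSumι N i) i)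
      exact (congr_arg (· + _) this).trans (add_sub_cancel _ _)
    obtain ⟨_, ⟨x, hx, rfl⟩, z, hz, rfl⟩ := AddSubgroup.mem_sup.1 h
    exact ⟨x, hx, by simpa using hz⟩

/-- The mapping cone of a direct sum of morphisms is the direct sum of the mapping cones. -/
def directSumConeIso {N : I → DGModule A} (f : ∀ i, M i ⟶ N i) :
    directSum (fun i => cone (f i)) ≅ cone (directSumMap f) := by
  let p : (directSum fun i => cone (f i)).carrier →ₗ[A.carrierᵐᵒᵖ] (directSum N).carrier :=
    directSumLift _ fun i => directSumSingle N i ∘ₗ LinearMap.fst _ (N i).carrier (M i).carrier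
  let q : (directSum fun i => cone (f i)).carrier →ₗ[A.carrierᵐᵒᵖ] (directSum M).carrier :=
    directSumLift _ fun i => directSumSingle M i ∘ₗ LinearMap.snd _ (N i).carrier (M i).carrier
  let a : (directSum N).carrier →ₗ[A.carrierᵐᵒᵖ] (directSum fun i => cone (f i)).carrier :=
    directSumLift N fun i => directSumSingle (fun i => cone (f i)) i ∘ₗ
      LinearMap.inl _ (N i).carrier (M i).carrier
  let b : (directSum M).carrier →ₗ[A.carrierᵐᵒᵖ] (directSum fun i => cone (f i)).carrier :=
    directSumLift M fun i => directSumSingle (fun i => cone (f i)) i ∘ₗ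
      LinearMap.inr _ (N i).carrier (M i).carrier
  have hp : ∀ z i, (directSumπ N i).toFun (p z) = ((directSumπ _ i).toFun z).1 :=
    directSumπ_lift_single (M := fun i => cone (f i))
      fun i => LinearMap.fst _ (N i).carrier (M i).carrier
  have hq : ∀ z i, (directSumπ M i).toFun (q z) = ((directSumπ _ i).toFun z).2 :=
    directSumπ_lift_single (M := fun i => cone (f i))
      fun i => LinearMap.snd _ (N i).carrier (M i).carrier
  have hab : ∀ y x i, (directSumπ (fun i => cone (f i)) i).toFun (a y + b x) =
      ((directSumπ N i).toFun y, (directSumπ M i).toFun x) := fun y x i => by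
    have ha := directSumπ_lift_single (N := fun i => cone (f i))
      (fun i => LinearMap.inl _ (N i).carrier (M i).carrier) y i
    have hb := directSumπ_lift_single (N := fun i => cone (f i))
      (fun i => LinearMap.inr _ (N i).carrier (M i).carrier) x i
    rw [map_add]
    refine (congr_arg₂ (· + ·) ha hb).trans (Prod.ext (add_zero _) (zero_add _))
  refine isoMk (N := cone (directSumMap f))
    (LinearEquiv.ofLinearMap (p.prod q) (a.coprod b) ?_ ?_) ?_ ?_ ?_
  · refine LinearMap.ext fun ⟨y, x⟩ => Prod.ext ?_ ?_
    · exact directSum_ext _ fun i => (hp _ i).trans (congr_arg Prod.fst (hab y x i))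
    · exact directSum_ext _ fun i => (hq _ i).trans (congr_arg Prod.snd (hab y x i))
  · exact LinearMap.ext fun z => directSum_ext _ fun i =>
      (hab _ _ i).trans (Prod.ext (hp z i) (hq z i))
  · intro n z hz
    rw [mem_directSum_gr] at hz
    exact ⟨(mem_directSum_gr _ _ _).2 fun i => (hp z i).symm ▸ (hz i).1,
      (mem_directSum_gr _ _ _).2 fun i => (hq z i).symm ▸ (hz i).2⟩
  · rintro n ⟨y, x⟩ ⟨hy, hx⟩
    refine (mem_directSum_gr _ _ _).2 fun i => (hab y x i).symm ▸ ⟨?_, ?_⟩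
    · exact (mem_directSum_gr _ _ _).1 hy i
    · exact (mem_directSum_gr _ _ _).1 hx i
  · intro z
    refine Prod.ext (directSum_ext _ fun i => ?_) (directSum_ext _ fun i => ?_)
    · change (directSumπ N i).toFun (p _) =
        (directSumπ N i).toFun ((directSum N).d (p z) + (directSumMap f).toFun (q z))
      rw [hp, map_add, (directSumπ N i).map_d, hp, directSumπ_map, hq, Hom.map_d]
      rfl
    · change (directSumπ M i).toFun (q _) = (directSumπ M i).toFun (-(directSum M).d (q z))
      rw [hq, map_neg, (directSumπ M i).map_d, hq, Hom.map_d]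
      rfl

end DirectSum

/-! ### Homotopy pullbacks and the calculus of right fractions -/

section HtpPullback

variable {M N P : DGModule A} (f : M ⟶ P) (g : N ⟶ P)

/-- The homotopy pullback of `f : M ⟶ P` and `g : N ⟶ P`: the graded module `(P[-1] ⊕ N) ⊕ M`
with differential `((w, y), x) ↦ ((g y - f x - d w, d y), d x)`. It is obtained as a mapping cone
of a morphism from `M[-1]` to the mapping cone of `g[-1]`. -/
def htpPullback : DGModule A :=
  cone (-(shiftFun A (-1)).map f ≫ (coneTriangle ((shiftFun A (-1)).map g)).mor₂)

lemma mem_htpPullback_gr (n : ℤ) (w : P.carrier) (y : N.carrier) (x : M.carrier) :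
    (show (htpPullback f g).carrier from ((w, y), x)) ∈ (htpPullback f g).gr n ↔
      w ∈ P.gr (n - 1) ∧ y ∈ N.gr n ∧ x ∈ M.gr n := by
  have h : n + 1 + -1 = n := by ring
  change (w ∈ P.gr (n + -1) ∧ y ∈ N.gr (n + 1 + -1)) ∧ x ∈ M.gr (n + 1 + -1) ↔ _
  rw [h, and_assoc, sub_eq_add_neg]

lemma htpPullback_d (w : P.carrier) (y : N.carrier) (x : M.carrier) :
    (htpPullback f g).d ((w, y), x) = ((g.toFun y - f.toFun x - P.d w, N.d y), M.d x) := by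
  change ((((-1 : ℤ).negOnePow • P.d w + g.toFun y, -((-1 : ℤ).negOnePow • N.d y)) +
    (-f.toFun x, -0), -((-1 : ℤ).negOnePow • M.d x)) :
    (P.carrier × N.carrier) × M.carrier) = _
  simp
  abel

/-- The first projection of the homotopy pullback. -/
def htpPullbackFst : htpPullback f g ⟶ M :=
  Hom.mk (M := htpPullback f g) (LinearMap.snd _ (P.carrier × N.carrier) M.carrier)
    (fun n z hz => ((mem_htpPullback_gr f g n z.1.1 z.1.2 z.2).1 hz).2.2)
    (fun z => congr_arg Prod.snd (htpPullback_d f g z.1.1 z.1.2 z.2))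

/-- The second projection of the homotopy pullback. -/
def htpPullbackSnd : htpPullback f g ⟶ N :=
  Hom.mk (M := htpPullback f g) (LinearMap.snd _ P.carrier N.carrier ∘ₗ
      LinearMap.fst _ (P.carrier × N.carrier) M.carrier)
    (fun n z hz => ((mem_htpPullback_gr f g n z.1.1 z.1.2 z.2).1 hz).2.1)
    (fun z => congr_arg (Prod.snd ∘ Prod.fst) (htpPullback_d f g z.1.1 z.1.2 z.2))

lemma htpPullback_homotopic :
    Homotopic (htpPullbackFst f g ≫ f) (htpPullbackSnd f g ≫ g) := by
  refine ⟨-(LinearMap.fst _ P.carrier N.carrier ∘ₗ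
      LinearMap.fst _ (P.carrier × N.carrier) M.carrier),
    fun n z hz => neg_mem ((mem_htpPullback_gr f g n z.1.1 z.1.2 z.2).1 hz).1, fun z => ?_⟩
  have h := congr_arg (Prod.fst ∘ Prod.fst) (htpPullback_d f g z.1.1 z.1.2 z.2)
  obtain ⟨⟨w, y⟩, x⟩ := z
  change P.carrier at w
  change (show P.carrier from ((htpPullback f g).d ((w, y), x)).1.1) =
    g.toFun y - f.toFun x - P.d w at h
  change f.toFun x - g.toFun y =
    -(show P.carrier from ((htpPullback f g).d ((w, y), x)).1.1) + P.d (-w)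
  rw [h, map_neg]
  abel

variable {f g} in
/-- A homotopy-commutative square factors through the homotopy pullback. -/
lemma exists_htpPullback_lift {X : DGModule A} (a : X ⟶ M) (b : X ⟶ N)
    (h : Homotopic (a ≫ f) (b ≫ g)) :
    ∃ l : X ⟶ htpPullback f g, l ≫ htpPullbackFst f g = a ∧ l ≫ htpPullbackSnd f g = b := by
  obtain ⟨s, hs, h⟩ := h
  refine ⟨Hom.mk (N := htpPullback f g)
    (LinearMap.prod (M₂ := P.carrier × N.carrier) ((-s).prod b.toFun) a.toFun)
    (fun n x hx => (mem_htpPullback_gr f g n (-s x) (b.toFun x) (a.toFun x)).2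
      ⟨neg_mem (hs n x hx), b.map_mem n x hx, a.map_mem n x hx⟩) (fun x => ?_), rfl, rfl⟩
  refine Eq.trans (b := ((g.toFun (b.toFun x) - f.toFun (a.toFun x) - P.d (-s x),
    N.d (b.toFun x)), M.d (a.toFun x))) (Prod.ext (Prod.ext ?_ (b.map_d x)) (a.map_d x))
    (htpPullback_d f g (-s x) (b.toFun x) (a.toFun x)).symm
  have h := h x
  change -s (X.d x) = g.toFun (b.toFun x) - f.toFun (a.toFun x) - P.d (-s x)
  change f.toFun (a.toFun x) - g.toFun (b.toFun x) = s (X.d x) + P.d (s x) at h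
  rw [← neg_sub (f.toFun (a.toFun x)), h, map_neg]
  abel

variable {g} in
/-- Quasi-isomorphisms are stable under homotopy pullback. -/
lemma HMap_htpPullbackFst_bijective (hg : ∀ n, Function.Bijective (HMap g n)) (n : ℤ) :
    Function.Bijective (HMap (htpPullbackFst f g) n) := by
  simp only [HMap_bijective_iff] at hg ⊢
  constructor
  · rintro ⟨⟨w, y⟩, x⟩ ⟨hz, hz'⟩ ⟨x', hx', rfl⟩
    change P.carrier at w
    change N.carrier at y
    obtain ⟨hw, hy, -⟩ := (mem_htpPullback_gr f g n w y (M.d x')).1 hz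
    have hd := (htpPullback_d f g w y (M.d x')).symm.trans hz'
    have hd₁ : g.toFun y - f.toFun (M.d x') - P.d w = 0 := congr_arg (Prod.fst ∘ Prod.fst) hd
    have hd₂ : N.d y = 0 := congr_arg (Prod.snd ∘ Prod.fst) hd
    have hgy : g.toFun y = P.d (f.toFun x' + w) := by
      rw [map_add, ← f.map_d, ← sub_eq_zero, ← hd₁]
      abel
    obtain ⟨y', hy', rfl⟩ := (hg n).1 y ⟨hy, hd₂⟩
      ⟨_, (P.gr (n - 1)).add_mem (f.map_mem _ _ hx') hw, hgy.symm⟩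
    -- The remaining obstruction is the class of a cocycle of `P`, which comes from `N`.
    obtain ⟨y'', hy'', u, hu, hu'⟩ := (hg (n - 1)).2 (w - (g.toFun y' - f.toFun x'))
      ⟨(P.gr (n - 1)).sub_mem hw
          ((P.gr (n - 1)).sub_mem (g.map_mem _ _ hy') (f.map_mem _ _ hx')), by
        change P.d _ = 0
        rw [map_sub, map_sub, ← g.map_d, ← f.map_d, ← neg_eq_zero, ← hd₁]
        abel⟩
    refine ⟨((-u, y' + y''), x'), (mem_htpPullback_gr f g (n - 1) _ _ _).2
      ⟨(P.gr (n - 1 - 1)).neg_mem hu, (N.gr (n - 1)).add_mem hy' hy''.1, hx'⟩, ?_⟩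
    refine (htpPullback_d f g _ _ _).trans (Prod.ext (Prod.ext ?_ ?_) rfl)
    · change g.toFun (y' + y'') - f.toFun x' - P.d (-u) = w
      rw [map_neg, hu', map_add]
      abel
    · change N.d (y' + y'') = N.d y'
      rw [map_add, show N.d y'' = 0 from hy''.2, add_zero]
  · intro x hx
    obtain ⟨y, hy, w, hw, hw'⟩ := (hg n).2 _ (map_cocycles f n hx)
    refine ⟨((-w, y), x), ⟨(mem_htpPullback_gr f g n _ _ _).2 ⟨neg_mem hw, hy.1, hx.1⟩, ?_⟩, ?_⟩
    · refine (htpPullback_d f g _ _ _).trans (Prod.ext (Prod.ext ?_ hy.2) hx.2)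
      change g.toFun y - f.toFun x - P.d (-w) = 0
      rw [map_neg, hw']
      abel
    · change x - x ∈ _
      rw [sub_self]
      exact zero_mem _

end HtpPullback

end DGModule

section Derived

open DGModule

variable {k : Type v} [CommRing k] (A : DGAlgebra.{v, u} k)

instance : (quasiIso A).IsMultiplicative where
  id_mem X n := by
    rw [CategoryTheory.Functor.map_id]
    infer_instance
  comp_mem f g hf hg n := by
    have := hf n
    have := hg n
    rw [Functor.map_comp]
    infer_instance

/-- Quasi-isomorphisms in the homotopy category admit a calculus of right fractions, by means of
homotopy pullbacks. -/
instance : (quasiIso A).HasRightCalculusOfFractions where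
  exists_rightFraction := by
    rintro ⟨M⟩ ⟨N⟩ φ
    obtain ⟨⟨P⟩, f, s, hs, rfl⟩ := φ.cases
    obtain ⟨f, rfl⟩ := (Quotient.functor (Homotopic (A := A))).map_surjective f
    obtain ⟨s, rfl⟩ := (Quotient.functor (Homotopic (A := A))).map_surjective s
    refine ⟨⟨(Quotient.functor _).map (htpPullbackFst f s),
      (quasiIso_functor_map_iff _).2
        (HMap_htpPullbackFst_bijective f ((quasiIso_functor_map_iff s).1 hs)),
      (Quotient.functor _).map (htpPullbackSnd f s)⟩, ?_⟩
    dsimp only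
    rw [← Functor.map_comp, ← Functor.map_comp]
    exact CategoryTheory.Quotient.sound _ (htpPullback_homotopic f s)
  ext := by
    rintro ⟨M⟩ ⟨N⟩ ⟨P⟩ f₁ f₂ s hs h
    obtain ⟨f₁, rfl⟩ := (Quotient.functor (Homotopic (A := A))).map_surjective f₁
    obtain ⟨f₂, rfl⟩ := (Quotient.functor (Homotopic (A := A))).map_surjective f₂
    obtain ⟨s, rfl⟩ := (Quotient.functor (Homotopic (A := A))).map_surjective s
    rw [← Functor.map_comp, ← Functor.map_comp, Quotient.functor_map_eq_iff] at h
    have hs' := HMap_htpPullbackFst_bijective s ((quasiIso_functor_map_iff s).1 hs)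
    -- `(f₁, f₂)` lifts to the path object `F` of `s`; pull this lift back along the diagonal of
    -- `F`, a quasi-isomorphism.
    obtain ⟨l, hl₁, hl₂⟩ := exists_htpPullback_lift f₁ f₂ h
    obtain ⟨δ, hδ₁, hδ₂⟩ := exists_htpPullback_lift (f := s) (g := s) (𝟙 N) (𝟙 N)
      (Congruence.equivalence.refl _)
    have hδ : ∀ n, Function.Bijective (HMap δ n) := by
      rw [← quasiIso_functor_map_iff]
      intro n
      have := (quasiIso_functor_map_iff (htpPullbackFst s s)).2 hs' n
      have h : (HtpCat.cohomology A n).map ((Quotient.functor _).map δ) ≫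
          (HtpCat.cohomology A n).map ((Quotient.functor _).map (htpPullbackFst s s)) = 𝟙 _ := by
        rw [← Functor.map_comp, ← Functor.map_comp, hδ₁, CategoryTheory.Functor.map_id,
          CategoryTheory.Functor.map_id]
      have : IsIso ((HtpCat.cohomology A n).map ((Quotient.functor _).map δ) ≫
          (HtpCat.cohomology A n).map ((Quotient.functor _).map (htpPullbackFst s s))) := by
        rw [h]; infer_instance
      exact IsIso.of_isIso_comp_right _
        ((HtpCat.cohomology A n).map ((Quotient.functor _).map (htpPullbackFst s s)))
    refine ⟨_, (Quotient.functor _).map (htpPullbackFst l δ),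
      (quasiIso_functor_map_iff _).2 (HMap_htpPullbackFst_bijective l hδ), ?_⟩
    have hc : (Quotient.functor Homotopic).map (htpPullbackFst l δ ≫ l) =
        (Quotient.functor Homotopic).map (htpPullbackSnd l δ ≫ δ) :=
      CategoryTheory.Quotient.sound _ (htpPullback_homotopic l δ)
    rw [← hl₁, ← hl₂, ← Functor.map_comp, ← Functor.map_comp, ← Category.assoc, ← Category.assoc,
      Functor.map_comp, hc, Functor.map_comp _ _ (htpPullbackSnd s s), hc, ← Functor.map_comp,
      ← Functor.map_comp, Category.assoc, Category.assoc, hδ₁, hδ₂]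

/-- The derived category is preadditive. -/
instance : Preadditive (Der A) :=
  Localization.preadditiveOfRightCalculus (quasiIso A).Q (quasiIso A)

end Derived

section Derived

open DGModule

variable {k : Type v} [CommRing k] {A : DGAlgebra.{v, u} k}

/-! ### Coproducts in the derived category -/

/-- The coproduct of a family of objects of the homotopy category. -/
def htpCofan {I : Type u} (X : I → HtpCat A) : Cofan X :=
  Cofan.mk ((Quotient.functor Homotopic).obj (directSum fun i => (X i).as))
    fun i => (Quotient.functor Homotopic).map (directSumι (fun i => (X i).as) i)

lemma htpCofan_hom_ext {I : Type u} (X : I → HtpCat A) {Y : HtpCat A}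
    (f g : (htpCofan X).pt ⟶ Y) (h : ∀ i, (htpCofan X).inj i ≫ f = (htpCofan X).inj i ≫ g) :
    f = g := by
  obtain ⟨f, rfl⟩ := (Quotient.functor (Homotopic (A := A))).map_surjective
    (X := directSum fun i => (X i).as) (Y := Y.as) f
  obtain ⟨g, rfl⟩ := (Quotient.functor (Homotopic (A := A))).map_surjective
    (X := directSum fun i => (X i).as) (Y := Y.as) g
  refine CategoryTheory.Quotient.sound _ (homotopic_of_directSum fun i => ?_)
  refine (Quotient.functor_map_eq_iff (Homotopic (A := A)) _ _).1 ?_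
  rw [Functor.map_comp, Functor.map_comp]
  exact h i

lemma htpCofan_inj_desc {I : Type u} (X : I → HtpCat A) {N : DGModule A}
    (f : ∀ i, (X i).as ⟶ N) (i : I) :
    (htpCofan X).inj i ≫ (Quotient.functor Homotopic).map (directSumDesc f) =
      (Quotient.functor Homotopic).map (f i) :=
  ((Quotient.functor Homotopic).map_comp _ _).symm.trans
    (congr_arg (Quotient.functor Homotopic).map (directSumι_desc f i))

/-- The direct sum of dg-modules is the coproduct in the homotopy category. -/
def htpCofanIsColimit {I : Type u} (X : I → HtpCat A) : IsColimit (htpCofan X) :=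
  Cofan.IsColimit.mk _
    (fun t => (Quotient.functor Homotopic).map (directSumDesc fun i =>
      (Quotient.functor Homotopic).preimage (X := (X i).as) (Y := t.pt.as) (t.inj i)))
    (fun _ i => (htpCofan_inj_desc X _ i).trans ((Quotient.functor Homotopic).map_preimage _))
    (fun _ _ hm => htpCofan_hom_ext X _ _ fun i => (hm i).trans
      ((htpCofan_inj_desc X _ i).trans ((Quotient.functor Homotopic).map_preimage _)).symm)

/-- The direct sum of dg-modules is the coproduct in the derived category. -/
theorem nonempty_isColimit_toDer_directSum {I : Type u} (M : I → DGModule A) :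
    Nonempty (IsColimit (Cofan.mk ((toDer A).obj (directSum M))
      fun i => (toDer A).map (directSumι M i))) := by
  refine Localization.nonempty_isColimit_cofan (quasiIso A).Q (quasiIso A)
    (htpCofan fun i => (Quotient.functor Homotopic).obj (M i)) fun X' s hs => ?_
  choose f hf using fun i => (Quotient.functor (Homotopic (A := A))).map_surjective
    (X := (X' i).as) (Y := M i) (s i)
  refine ⟨htpCofan X', htpCofanIsColimit X',
    (Quotient.functor Homotopic).map (directSumMap f), fun i => ?_, ?_⟩
  · refine (htpCofan_inj_desc X' _ i).trans ?_
    rw [Functor.map_comp, hf]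
    rfl
  · refine (quasiIso_functor_map_iff _).2 fun n => HMap_directSumMap_bijective f n fun i => ?_
    have h := hs i
    rw [← hf i] at h
    exact (quasiIso_functor_map_iff (f i)).1 h n

lemma exists_toDer_iso (X : Der A) : ∃ M : DGModule A, Nonempty (X ≅ (toDer A).obj M) := by
  have := CategoryTheory.Localization.essSurj (quasiIso A).Q (quasiIso A)
  exact ⟨((quasiIso A).Q.objPreimage X).as, ⟨((quasiIso A).Q.objObjPreimageIso X).symm⟩⟩

lemma exists_copower (I : Type u) (X : Der A) :
    ∃ c : Cofan fun _ : I => X, Nonempty (IsColimit c) := by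
  obtain ⟨M, ⟨e⟩⟩ := exists_toDer_iso X
  obtain ⟨h⟩ := nonempty_isColimit_toDer_directSum fun _ : I => M
  exact ⟨Cofan.mk _ fun i => e.hom ≫ (toDer A).map (directSumι (fun _ => M) i),
    ⟨Cofan.IsColimit.mk _ (fun t => Cofan.IsColimit.desc h fun i => e.inv ≫ t.inj i)
      (fun t i => by
        rw [cofan_mk_inj, Category.assoc]
        erw [Cofan.IsColimit.fac h]
        rw [e.hom_inv_id_assoc])
      (fun t m hm => Cofan.IsColimit.hom_ext h _ _ fun i => by
        rw [Cofan.IsColimit.fac, ← hm i, cofan_mk_inj, cofan_mk_inj, Category.assoc,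
          e.inv_hom_id_assoc])⟩⟩

/-- The copower `X^(I)` in the derived category. -/
def copower (I : Type u) (X : Der A) : Cofan fun _ : I => X := (exists_copower I X).choose

/-- The universal property of the copower. -/
def copowerIsColimit (I : Type u) (X : Der A) : IsColimit (copower I X) :=
  (exists_copower I X).choose_spec.some

lemma isZero_copower (I : Type u) {X : Der A} (hX : IsZero X) : IsZero (copower I X).pt := by
  rw [IsZero.iff_id_eq_zero]
  exact Cofan.IsColimit.hom_ext (copowerIsColimit I X) _ _ fun i => hX.eq_of_src _ _

/-! ### Distinguished triangles -/

lemma isTriangle_of_iso {X Y Z : Der A} {T : Triangle (Der A)} (hT : T ∈ distTriangles A)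
    (e₁ : X ≅ T.obj₁) (e₂ : Y ≅ T.obj₂) (e₃ : Z ≅ T.obj₃) : IsTriangle X Y Z := by
  obtain ⟨M, N, f, ⟨e⟩⟩ := hT
  have h₁ : (e₁.hom ≫ T.mor₁ ≫ e₂.inv) ≫ e₂.hom = e₁.hom ≫ T.mor₁ := by simp
  have h₂ : (e₂.hom ≫ T.mor₂ ≫ e₃.inv) ≫ e₃.hom = e₂.hom ≫ T.mor₂ := by simp
  have h₃ : (e₃.hom ≫ T.mor₃ ≫ e₁.inv⟦(1 : ℤ)⟧') ≫ e₁.hom⟦(1 : ℤ)⟧' = e₃.hom ≫ T.mor₃ := by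
    simp [← Functor.map_comp]
  exact ⟨e₁.hom ≫ T.mor₁ ≫ e₂.inv, e₂.hom ≫ T.mor₂ ≫ e₃.inv,
    e₃.hom ≫ T.mor₃ ≫ e₁.inv⟦(1 : ℤ)⟧', M, N, f,
    ⟨Triangle.isoMk _ _ e₁ e₂ e₃ h₁ h₂ h₃ ≪≫ e⟩⟩

/-- The triples of objects underlying distinguished triangles are, up to isomorphism, those of the
form `(M, N, cone f)`. -/
lemma isTriangle_iff {X Y Z : Der A} :
    IsTriangle X Y Z ↔ ∃ (M N : DGModule A) (f : M ⟶ N), Nonempty (X ≅ (toDer A).obj M) ∧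
      Nonempty (Y ≅ (toDer A).obj N) ∧ Nonempty (Z ≅ (toDer A).obj (cone f)) := by
  constructor
  · rintro ⟨a, b, c, M, N, f, ⟨e⟩⟩
    exact ⟨M, N, f, ⟨Triangle.π₁.mapIso e⟩, ⟨Triangle.π₂.mapIso e⟩, ⟨Triangle.π₃.mapIso e⟩⟩
  · rintro ⟨M, N, f, ⟨e₁⟩, ⟨e₂⟩, ⟨e₃⟩⟩
    exact isTriangle_of_iso (T := (toDer A).mapTriangle.obj (coneTriangle f))
      ⟨M, N, f, ⟨Iso.refl _⟩⟩ e₁ e₂ e₃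

/-- Copowers of distinguished triangles are distinguished. -/
lemma IsTriangle.copower {X Y Z : Der A} (h : IsTriangle X Y Z) (I : Type u) :
    IsTriangle (copower I X).pt (copower I Y).pt (copower I Z).pt := by
  obtain ⟨M, N, f, ⟨e₁⟩, ⟨e₂⟩, ⟨e₃⟩⟩ := isTriangle_iff.1 h
  have key : ∀ {X : Der A} {M : DGModule A}, (X ≅ (toDer A).obj M) →
      Nonempty ((_root_.copower I X).pt ≅ (toDer A).obj (directSum fun _ : I => M)) :=
    fun {X M} e => ⟨Cofan.copowerIso e _ (copowerIsColimit I X) _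
      (nonempty_isColimit_toDer_directSum fun _ : I => M).some⟩
  refine isTriangle_iff.2 ⟨_, _, directSumMap fun _ : I => f, key e₁, key e₂, ?_⟩
  exact ⟨(key e₃).some ≪≫ (toDer A).mapIso (directSumConeIso fun _ : I => f)⟩

/-- The zero dg-module, as an empty direct sum. -/
def zeroModule (A : DGAlgebra.{v, u} k) : DGModule A :=
  directSum (PEmpty.elim : PEmpty.{u + 1} → DGModule A)

lemma zeroModule_eq_zero (x : (zeroModule A).carrier) : x = 0 :=
  directSum_ext _ fun i => i.elim

lemma isZero_toDer_zeroModule : IsZero ((toDer A).obj (zeroModule A)) := by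
  obtain ⟨h⟩ := nonempty_isColimit_toDer_directSum (PEmpty.elim : PEmpty.{u + 1} → DGModule A)
  rw [IsZero.iff_id_eq_zero]
  exact Cofan.IsColimit.hom_ext h _ _ fun i => i.elim

/-- The triangle `0 ⟶ W ⟶ W`, the identity of `W` being the second map. -/
lemma isTriangle_of_isZero_left {Z : Der A} (hZ : IsZero Z) (W : Der A) : IsTriangle Z W W := by
  obtain ⟨N, ⟨e⟩⟩ := exists_toDer_iso W
  have hO := zeroModule_eq_zero (A := A)
  let i : N ≅ cone (0 : zeroModule A ⟶ N) := isoMk (N := cone (0 : zeroModule A ⟶ N))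
    (LinearEquiv.ofLinearMap (LinearMap.inl _ N.carrier (zeroModule A).carrier)
      (LinearMap.fst _ N.carrier (zeroModule A).carrier)
      (LinearMap.ext fun z => Prod.ext rfl (hO z.2).symm) (LinearMap.ext fun z => rfl))
    (fun n x hx => ⟨hx, zero_mem _⟩) (fun n x hx => hx.1)
    (fun x => Prod.ext (add_zero _).symm ((hO _).trans (hO _).symm))
  exact isTriangle_iff.2 ⟨zeroModule A, N, 0, ⟨hZ.iso isZero_toDer_zeroModule⟩, ⟨e⟩,
    ⟨e ≪≫ (toDer A).mapIso i⟩⟩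

/-- The triangle `W ⟶ W ⟶ 0`, the identity of `W` being the first map. -/
lemma isTriangle_of_isZero_right {Z : Der A} (hZ : IsZero Z) (W : Der A) : IsTriangle W W Z := by
  obtain ⟨N, ⟨e⟩⟩ := exists_toDer_iso W
  refine isTriangle_iff.2 ⟨N, N, 𝟙 N, ⟨e⟩, ⟨e⟩, ⟨hZ.iso ?_⟩⟩
  -- The cone of an identity is contractible.
  have h : Homotopic (𝟙 (cone (𝟙 N))) 0 :=
    ⟨LinearMap.inr _ N.carrier N.carrier ∘ₗ LinearMap.fst _ N.carrier N.carrier,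
      fun n x hx => ⟨zero_mem _, by
        change x.1 ∈ N.gr (n - 1 + 1)
        rw [sub_add_cancel]
        exact hx.1⟩, fun x => by
        refine Prod.ext ?_ ?_
        · change x.1 - 0 = 0 + (N.d 0 + x.1)
          simp
        · change x.2 - 0 = N.d x.1 + x.2 + -N.d x.1
          abel⟩
  -- Hence its identity factors through the zero object.
  have h' : 𝟙 ((toDer A).obj (cone (𝟙 N))) = (toDer A).map (0 : _ ⟶ zeroModule A) ≫
      (toDer A).map (0 : zeroModule A ⟶ _) := by
    rw [← Functor.map_comp, comp_zero, ← CategoryTheory.Functor.map_id]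
    exact congr_arg (quasiIso A).Q.map (CategoryTheory.Quotient.sound _ h)
  rw [IsZero.iff_id_eq_zero, h', isZero_toDer_zeroModule.eq_of_tgt ((toDer A).map _) 0, zero_comp]

/-! ### Copowers of silting objects -/

lemma AddClosure.of_retract {U X Y : Der A} (r : Retract X Y) (hY : AddClosure U Y) :
    AddClosure U X := by
  obtain ⟨I, c, hc, ⟨r'⟩⟩ := hY
  exact ⟨I, c, hc, ⟨r.trans r'⟩⟩

lemma AddClosure.copower {U X : Der A} (hX : AddClosure U X) {J : Type u}
    (d : Cofan fun _ : J => X) (hd : IsColimit d) : AddClosure U d.pt := by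
  obtain ⟨I, c, ⟨hc⟩, ⟨r⟩⟩ := hX
  exact ⟨J × I, _, ⟨Cofan.isColimitProd c hc _ (copowerIsColimit J c.pt)⟩,
    ⟨Cofan.retract (fun _ => r) d hd _ (copowerIsColimit J c.pt)⟩⟩

lemma AddClosure.trans {U V X : Der A} (hV : AddClosure U V) (hX : AddClosure V X) :
    AddClosure U X := by
  obtain ⟨I, c, ⟨hc⟩, ⟨r⟩⟩ := hX
  exact (hV.copower c hc).of_retract r

lemma addClosure_of_retract {W X : Der A} (r : Retract X W) : addClosure W X :=
  ⟨PUnit, inferInstance, _, ⟨Cofan.isColimitPUnit W⟩, ⟨r⟩⟩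

lemma AddClosure.of_retract_self {W X : Der A} (r : Retract X W) : AddClosure W X := by
  obtain ⟨I, _, c, h⟩ := addClosure_of_retract r
  exact ⟨I, c, h⟩

/-- The resolution dimension does not increase under copowers. -/
lemma DimLE.copower {U X : Der A} {n : ℕ} (h : DimLE (AddClosure U) X n) (J : Type u) :
    DimLE (AddClosure U) (copower J X).pt n := by
  obtain ⟨Y, C, h⟩ := h
  exact ⟨fun i => (_root_.copower J (Y i)).pt, fun i => (_root_.copower J (C i)).pt,
    { start := ⟨Cofan.copowerIso h.start.some _ (copowerIsColimit J _) _ (copowerIsColimit J _)⟩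
      mem := fun i hi => (h.mem i hi).copower _ (copowerIsColimit J _)
      triangle := fun i hi => (h.triangle i hi).copower J
      isZero := isZero_copower J h.isZero }⟩

/-- A nonempty copower of a silting object is silting. -/
lemma IsSilting.copower {U : Der A} (hU : IsSilting U) (J : Type u)
    (hA : AddClosure U = AddClosure (copower J U).pt) : IsSilting (copower J U).pt where
  dim_finite := hU.dim_finite.imp fun _ h => h.copower J
  orthogonal I c := by
    rintro ⟨hc⟩ i hi
    have := hU.orthogonal _ _ ⟨Cofan.isColimitProd _ (copowerIsColimit J U) c hc⟩ i hi
    exact ⟨fun f g => Cofan.IsColimit.hom_ext (copowerIsColimit J U) f g fun j =>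
      this.elim _ _⟩
  codim_finite := hA ▸ hU.codim_finite

lemma AddClosure_copower_eq (U : Der A) (J : Type u) [Nonempty J] :
    AddClosure U = AddClosure (copower J U).pt := by
  have h₁ : AddClosure U (copower J U).pt :=
    (AddClosure.of_retract_self (Retract.refl U)).copower _ (copowerIsColimit J U)
  have h₂ : AddClosure (copower J U).pt U :=
    .of_retract_self (Cofan.retractOfInjective
      (fun _ : PUnit.{u + 1} => Classical.arbitrary J) (fun _ _ _ => rfl) _
      (Cofan.isColimitPUnit U) _ (copowerIsColimit J U))
  funext X
  exact propext ⟨h₂.trans, h₁.trans⟩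

/-- For an index set of the form `ℕ × K`, the copower `U^(ℕ × K)` is its own countable copower. -/
lemma exists_countable_copower_iso (U : Der A) (K : Type u) :
    ∃ w : Cofan fun _ : ℕ => (copower (ℕ × K) U).pt, Nonempty (IsColimit w) ∧
      Nonempty (w.pt ≅ (copower (ℕ × K) U).pt) := by
  let W := (copower (ℕ × K) U).pt
  let w := Cofan.mk (f := fun _ : ℕ => W) _ fun n => (copower (ULift.{u} ℕ) W).inj (.up n)
  have hw : IsColimit w :=
    Cofan.isColimitReindex Equiv.ulift.symm _ (copowerIsColimit (ULift.{u} ℕ) W)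
  have e : ℕ × K ≃ ℕ × ℕ × K :=
    (Equiv.prodCongr Nat.pairEquiv.symm (Equiv.refl K)).trans (Equiv.prodAssoc ℕ ℕ K)
  exact ⟨w, ⟨hw⟩, ⟨Cofan.copowerIso (Iso.refl U) _
    (Cofan.isColimitReindex e _ (Cofan.isColimitProd _ (copowerIsColimit (ℕ × K) U) w hw)) _
    (copowerIsColimit (ℕ × K) U)⟩⟩

/-- A coresolution can be prolonged by two equal terms `W`, using the triangles `0 ⟶ W ⟶ W`
and `W ⟶ W ⟶ 0`. -/
lemma IsCoresolution.prolong {P Q : ObjectProperty (Der A)} {X : Der A} {n : ℕ} {Y C : ℕ → Der A}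
    (h : IsCoresolution P X n Y C) {W : Der A} (hC : ∀ i ≤ n, Q (C i)) (hW : Q W) :
    IsCoresolution Q X (n + 2)
      (fun i => if i ≤ n + 1 then Y i else if i = n + 2 then W else Y (n + 1))
      (fun i => if i ≤ n then C i else W) where
  start := by simpa using h.start
  mem i hi := by
    split_ifs with h'
    exacts [hC i h', hW]
  triangle i hi := by
    obtain hi | rfl | rfl : i ≤ n ∨ i = n + 1 ∨ i = n + 2 := by omega
    · simpa [hi, hi.trans n.le_succ] using h.triangle i hi
    · simpa using isTriangle_of_isZero_left h.isZero W
    · simpa using isTriangle_of_isZero_right h.isZero W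
  isZero := by simpa using h.isZero

end Derived

end

/-! ### The good silting object -/

theorem lemma2p3 {k : Type v} [CommRing k] (A : DGAlgebra.{v, u} k) (U : Der A)
    (hU : IsSilting U) :
    ∃ U' : Der A, IsGoodSilting U' ∧ SiltingEquivalent U U' ∧
      (∀ n : ℕ, IsNSilting n U → IsNSilting n U') ∧
      (∀ n : ℕ, IsNSilting' n U → IsNSilting' n U') ∧
      ∃ (m : ℕ) (Y C : ℕ → Der A) (c : Cofan (fun i : Fin (m + 1) => C i)),
        IsCoresolution (AddClosure U) A.inDer m Y C ∧ Nonempty (IsColimit c) ∧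
        Nonempty (c.pt ≅ U') := by
  obtain ⟨n, Y, C, h⟩ := hU.codim_finite
  choose I c hc r using fun i : Fin (n + 1) => h.mem i (Nat.lt_succ_iff.1 i.2)
  -- The index set contains all `I i`, is nonempty, and absorbs a factor `ℕ`.
  let K : Type u := Option (Σ i, I i)
  let W : Der A := (copower (ℕ × K) U).pt
  have hA : AddClosure U = AddClosure W := AddClosure_copower_eq U (ℕ × K)
  have hW : IsSilting W := hU.copower (ℕ × K) hA
  have hr : ∀ i ≤ n, Nonempty (Retract (C i) W) := fun i hi => by
    let j : Fin (n + 1) := ⟨i, Nat.lt_succ_iff.2 hi⟩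
    refine ⟨(r j).some.trans (Cofan.retractOfInjective (fun x => (0, some ⟨j, x⟩)) ?_ _
      (hc j).some _ (copowerIsColimit (ℕ × K) U))⟩
    intro x y hxy
    simpa using hxy
  have hr' : ∀ i, Nonempty (Retract (if i ≤ n then C i else W) W) := fun i => by
    split_ifs with hi
    exacts [hr i hi, ⟨Retract.refl W⟩]
  obtain ⟨w, ⟨hw⟩, ⟨e⟩⟩ := exists_countable_copower_iso U K
  obtain ⟨d, hd, hdW⟩ := exists_isColimit_cofan_of_retract w hw e (n + 2)
    (fun i => if (i : ℕ) ≤ n then C i else W) (fun i => hr' i) (by simp [W])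
  refine ⟨W, ⟨hW, n + 2, _, _, h.prolong (fun i hi => addClosure_of_retract (hr i hi).some)
      (addClosure_of_retract (Retract.refl W))⟩, hA,
    fun n hn => ⟨hW, hA ▸ hn.codimLE⟩, fun n hn => ⟨hW, hn.dimLE.copower (ℕ × K)⟩,
    n + 2, _, _, d, h.prolong h.mem ?_, hd, hdW⟩
  rw [hA]
  exact .of_retract_self (Retract.refl W)
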